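/- Call a connected graph $G=(V,E)$ $\delta$-hyperbolic if $d(a,b)+d(c,e)\le\max\{d(a,c)+d(b,e),\,d(a,e)+d(b,c)\}+\delta$ for all $a,b,c,e\in V$, where $d$ is the shortest-path distance. The problem Hyperbolicity is to decide, given a connected graph $G$ on $n\ge 1$ vertices (by the list of its edges) and an integer $1\le\delta\le n$, whether $G$ is $\delta$-hyperbolic. Algorithms are deterministic random access machines with logarithmic cost, with addition, truncated subtraction, multiplication, integer division and indirect addressing. SETH is the hypothesis that for every $\varepsilon>0$ there is a $k$ such that no algorithm decides the satisfiability of $k$-CNF formulas with $n$ variables and $m$ clauses in time $2^{(1-\varepsilon)n}\cdot\mathrm{poly}(n+m)$. **Theorem.** Assume SETH. Then for every function $f:\mathbb N\to\mathbb R$ and every $\varepsilon>0$ there is no algorithm that solves Hyperbolicity in time $f(\Delta)\cdot n^{2-\varepsilon}$, where $\Delta$ is the maximum degree of the input graph. Indeed, for every $\varepsilon>0$ there is no algorithm that solves Hyperbolicity on connected graphs of maximum degree at most five in time $O(n^{2-\varepsilon})$. -/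

import Mathlib

/-! Random access machines with logarithmic cost, the Strong Exponential Time Hypothesis, and the
decision problem Hyperbolicity. -/

namespace RAM

/-- The machine has registers, which the program addresses by name, and a main memory, which is
addressed indirectly. All registers and memory cells hold natural numbers. -/
structure State where
  reg : ℕ → ℕ
  mem : ℕ → ℕ

/-- Arithmetic operations; subtraction is truncated, and a quotient by zero is zero. -/
inductive Op
  | add
  | sub
  | mul
  | div

def Op.eval : Op → ℕ → ℕ → ℕ
  | .add, a, b => a + b
  | .sub, a, b => a - b
  | .mul, a, b => a * b
  | .div, a, b => a / b

/-- Random access machine programs, with structured control flow. -/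
inductive Prog
  /-- `reg i := c` -/
  | const (i c : ℕ)
  /-- `reg i := reg j ∘ reg k` for an arithmetic operation `∘` -/
  | arith (o : Op) (i j k : ℕ)
  /-- `reg i := mem (reg j)` -/
  | load (i j : ℕ)
  /-- `mem (reg i) := reg j` -/
  | store (i j : ℕ)
  /-- run `p`, then `q` -/
  | seq (p q : Prog)
  /-- if `reg i ≠ 0` then run `p`, else run `q` -/
  | ite (i : ℕ) (p q : Prog)
  /-- as long as `reg i ≠ 0`, run `p` -/
  | loop (i : ℕ) (p : Prog)

def State.setReg (s : State) (i v : ℕ) : State := ⟨Function.update s.reg i v, s.mem⟩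

def State.setMem (s : State) (a v : ℕ) : State := ⟨s.reg, Function.update s.mem a v⟩

/-- `Exec p s s' t`: started in state `s`, the program `p` halts in state `s'` at logarithmic cost
`t`. Each executed instruction costs one plus the numbers of binary digits (`Nat.size`) of the
constant, the operands and the memory address that it handles. Names of registers are part of the
program text and are not charged. -/
inductive Exec : Prog → State → State → ℕ → Prop
  | const (i c : ℕ) (s : State) :
      Exec (.const i c) s (s.setReg i c) (1 + c.size)
  | arith (o : Op) (i j k : ℕ) (s : State) :
      Exec (.arith o i j k) s (s.setReg i (o.eval (s.reg j) (s.reg k)))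
        (1 + (s.reg j).size + (s.reg k).size)
  | load (i j : ℕ) (s : State) :
      Exec (.load i j) s (s.setReg i (s.mem (s.reg j)))
        (1 + (s.reg j).size + (s.mem (s.reg j)).size)
  | store (i j : ℕ) (s : State) :
      Exec (.store i j) s (s.setMem (s.reg i) (s.reg j))
        (1 + (s.reg i).size + (s.reg j).size)
  | seq {p q : Prog} {s s' s'' : State} {t t' : ℕ} :
      Exec p s s' t → Exec q s' s'' t' → Exec (.seq p q) s s'' (t + t')
  | iteTrue {i : ℕ} {p q : Prog} {s s' : State} {t : ℕ} :
      s.reg i ≠ 0 → Exec p s s' t → Exec (.ite i p q) s s' (1 + (s.reg i).size + t)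
  | iteFalse {i : ℕ} {p q : Prog} {s s' : State} {t : ℕ} :
      s.reg i = 0 → Exec q s s' t → Exec (.ite i p q) s s' (1 + (s.reg i).size + t)
  | loopDone {i : ℕ} {p : Prog} {s : State} :
      s.reg i = 0 → Exec (.loop i p) s s (1 + (s.reg i).size)
  | loopStep {i : ℕ} {p : Prog} {s s' s'' : State} {t t' : ℕ} :
      s.reg i ≠ 0 → Exec p s s' t → Exec (.loop i p) s' s'' t' →
        Exec (.loop i p) s s'' (1 + (s.reg i).size + t + t')

/-- The initial state on input `x`: the entries of `x` stand in the memory cells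
`0, …, x.length - 1`, register `0` holds `x.length`, and everything else is zero. -/
def init (x : List ℕ) : State where
  reg := fun i => if i = 0 then x.length else 0
  mem := fun a => x.getD a 0

/-- On input `x` the program `P` halts at cost at most `B`, and it accepts (a nonzero value in
register `0`) if and only if `answer` is true. -/
def Prog.DecidesWithin (P : Prog) (x : List ℕ) (answer : Prop) (B : ℝ) : Prop :=
  ∃ (s : State) (t : ℕ), Exec P (init x) s t ∧ (s.reg 0 ≠ 0 ↔ answer) ∧ (t : ℝ) ≤ B

end RAM

/-! ### Satisfiability and SETH -/

/-- Formulas in conjunctive normal form over the variables `0, …, n - 1`: lists of clauses, which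
are lists of literals. The literal `(v, b)` says that the variable `v` has the truth value `b`. -/
abbrev CNF (n : ℕ) := List (List (Fin n × Bool))

namespace CNF

def Satisfiable {n : ℕ} (φ : CNF n) : Prop :=
  ∃ σ : Fin n → Bool, ∀ C ∈ φ, ∃ l ∈ C, σ l.1 = l.2

/-- `φ` is a `k`-CNF formula: its clauses have at most `k` literals. -/
def IsKCNF {n : ℕ} (k : ℕ) (φ : CNF n) : Prop :=
  ∀ C ∈ φ, C.length ≤ k

/-- The number of variables, the number of clauses, and then for each clause its length followed
by its literals, where `(v, b)` is written as `2 * v + b`. -/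
def encode {n : ℕ} (φ : CNF n) : List ℕ :=
  n :: φ.length ::
    φ.flatMap (fun C => C.length :: C.map (fun l => 2 * (l.1 : ℕ) + l.2.toNat))

end CNF

/-- Strong Exponential Time Hypothesis: for every `ε > 0` there is a `k` such that no algorithm
decides `k`-SAT in time `2 ^ ((1 - ε) n)` times a polynomial in the numbers `n` of variables and
`m` of clauses. -/
def SETH : Prop :=
  ∀ ε : ℝ, 0 < ε → ∃ k : ℕ, ¬ ∃ (P : RAM.Prog) (c d : ℕ), ∀ (n : ℕ) (φ : CNF n),
    φ.IsKCNF k →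
      P.DecidesWithin φ.encode φ.Satisfiable
        (c * (2 : ℝ) ^ ((1 - ε) * n) * ((n : ℝ) + φ.length + 1) ^ d)

/-! ### Hyperbolicity -/

/-- The four-point condition: the graph `G` is `δ`-hyperbolic. (Used for connected graphs.) -/
def SimpleGraph.IsHyperbolic {V : Type*} (G : SimpleGraph V) (δ : ℕ) : Prop :=
  ∀ a b c d : V,
    G.dist a b + G.dist c d ≤ max (G.dist a c + G.dist b d) (G.dist a d + G.dist b c) + δ

/-- The list `es` contains each edge of `G` exactly once (in any order and orientation), and
nothing else. -/
def SimpleGraph.IsEdgeList {V : Type*} (G : SimpleGraph V) (es : List (V × V)) : Prop :=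
  (es.map (fun e => s(e.1, e.2))).Nodup ∧
    ∀ e : Sym2 V, e ∈ es.map (fun e => s(e.1, e.2)) ↔ e ∈ G.edgeSet

/-- An instance of Hyperbolicity: the number of vertices, the integer `δ`, and the endpoints of
the edges one after the other. -/
def encodeHyperbolicity (n δ : ℕ) (es : List (Fin n × Fin n)) : List ℕ :=
  n :: δ :: es.flatMap (fun e => [(e.1 : ℕ), (e.2 : ℕ)])

/-- For every `δ ∈ {1, …, n}`, and however the edges of `G` are listed, the program `P` decides at
cost at most `B` whether `G` is `δ`-hyperbolic. (A connected graph on `n` vertices is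
`δ`-hyperbolic for each `δ ≥ n`, so that larger values of `δ` are of no interest.) -/
def RAM.Prog.SolvesHyperbolicityOn (P : RAM.Prog) {n : ℕ} (G : SimpleGraph (Fin n)) (B : ℝ) :
    Prop :=
  ∀ (δ : ℕ) (es : List (Fin n × Fin n)), 1 ≤ δ → δ ≤ n → G.IsEdgeList es →
    P.DecidesWithin (encodeHyperbolicity n δ es) (G.IsHyperbolic δ) B

/-!
The proof reduces the satisfiability of a formula with `n` variables and `m` clauses to
Hyperbolicity on a graph with `2 ^ (n / 2) * poly (n + m)` vertices and maximum degree five. A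
program for Hyperbolicity that is faster than quadratic then decides satisfiability faster than
SETH permits, whatever the width of the clauses.

**Vectors.** The variables are split into two sides, by parity, and each assignment to one side is
turned into a vector, the set of the clauses that it does not satisfy, so that the formula is
satisfiable if and only if vectors from different sides are disjoint. Four further coordinates and
three further vectors are added: the coordinates make vectors from the same side intersect, the
vector `0` contains all coordinates, and the vectors `1` and `2` are disjoint but meet all others.
Thus the formula is satisfiable if and only if there is a disjoint pair besides the pair `1`, `2`.

**The graph.** In the bipartite incidence graph of vectors and coordinates, two vectors are at
distance `2` or `4` according to whether they intersect. Each edge is replaced by a path of length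
`L`, each coordinate by a binary tree, and each vector by a path, its spine. This bounds the degree
and changes distances only by lower order terms, as trees have logarithmic depth and `L` is a large
multiple of this depth and of the number of coordinates. The last edge of the path of a nonincident
pair is bent back to the beginning of the path, so that the vertex set depends only on `n` and
`m`.

**Hyperbolicity.** A disjoint pair `a`, `b` of assignments and the vectors `1`, `2` have
`d(a, b) + d(1, 2) ≥ 8 * L`, while the other two sums are about `4 * L`. The lower bounds come from
a `1`-Lipschitz potential (`IncidenceGraph.Link.potential_le`). Conversely, if `1`, `2` is the only
disjoint pair, then any two vertices are at distance at most about `7 / 2 * L`, except for pairs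
close to the spines of `1` and `2` (`IncidenceGraph.near_or_high`). As the defect
`d(a, b) + d(c, e) - max (d(a, c) + d(b, e)) (d(a, e) + d(b, c))` is at most `d(a, b)`, at most
`d(c, e)`, and at most `2 * d(a, c)`, it is never larger than about `7 / 2 * L`. So
`IncidenceGraph.isHyperbolic` needs only upper bounds for distances.

**The machine.** The reduction has to run on the random access machine. Straight-line programs with
compound expressions are compiled to machine programs whose cost is linear in the sizes of the
registers (`RAM.Block.runs_compile`); the rest are loops with a counter. The program packs the
formula into one register, as the digits of a single number, and clears the memory. Since
polynomial factors do not matter, each incidence is found by scanning the packed formula, and the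
edges are written to the memory in the order of their numbers
(`HyperbolicityReduction.runs_construct`).
-/

/-! ### The incidence graph of a family of vectors -/

namespace IncidenceGraph

/-- The number of the vertex in position `t ≤ L` of the path that belongs to the vector `v` and
the coordinate `κ < K`. -/
def vertex (K L v κ t : ℕ) : ℕ := (v * K + κ) * (L + 1) + t

/-- The directed edges of the incidence graph of the vectors `v` with supports
`{κ < K | I v κ}`. For each coordinate `κ` the vertices in position `0` form a binary tree, in
which `v / 2` is the parent of `v`; for each vector `v` the vertices in position `L` form a path,
the spine of `v`. A path of length `L` leads from the tree of `κ` to the spine of `v` if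
`I v κ` holds. Otherwise its last edge is bent back to its start. -/
inductive Link (K L : ℕ) (I : ℕ → ℕ → Prop) : ℕ → ℕ → Prop
  | tree (v κ : ℕ) : κ < K → v ≠ 0 → Link K L I (vertex K L v κ 0) (vertex K L (v / 2) κ 0)
  | path (v κ t : ℕ) : κ < K → t < L → (t + 1 = L → I v κ) →
      Link K L I (vertex K L v κ t) (vertex K L v κ (t + 1))
  | loop (v κ : ℕ) : κ < K → ¬ I v κ → Link K L I (vertex K L v κ (L - 1)) (vertex K L v κ 0)
  | spine (v κ : ℕ) : κ + 1 < K → Link K L I (vertex K L v κ L) (vertex K L v (κ + 1) L)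

/-- The number of vertices of the incidence graph of `X` vectors. -/
def order (K X L : ℕ) : ℕ := X * K * (L + 1)

/-- The incidence graph of the vectors `0, …, X - 1`. -/
def graph (K X L : ℕ) (I : ℕ → ℕ → Prop) : SimpleGraph (Fin (order K X L)) :=
  SimpleGraph.fromRel fun a b => Link K L I a b

theorem vertex_lt {K X L v κ t : ℕ} (hv : v < X) (hκ : κ < K) (ht : t ≤ L) :
    vertex K L v κ t < order K X L := by
  unfold vertex order
  have h1 : v * K + κ + 1 ≤ X * K := by nlinarith
  nlinarith

theorem vertex_mod {K L v κ t : ℕ} (ht : t ≤ L) : vertex K L v κ t % (L + 1) = t := by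
  unfold vertex
  rw [mul_comm, Nat.mul_add_mod, Nat.mod_eq_of_lt (by omega)]

theorem vertex_div {K L v κ t : ℕ} (ht : t ≤ L) :
    vertex K L v κ t / (L + 1) = v * K + κ := by
  unfold vertex
  rw [mul_comm, Nat.mul_add_div (by omega), Nat.div_eq_of_lt (by omega), add_zero]

theorem vertex_div_mod {K L v κ t : ℕ} (hκ : κ < K) (ht : t ≤ L) :
    vertex K L v κ t / (L + 1) % K = κ := by
  rw [vertex_div ht, mul_comm, Nat.mul_add_mod, Nat.mod_eq_of_lt hκ]

theorem vertex_div_div {K L v κ t : ℕ} (hκ : κ < K) (ht : t ≤ L) :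
    vertex K L v κ t / (L + 1) / K = v := by
  rw [vertex_div ht, mul_comm, Nat.mul_add_div (by omega), Nat.div_eq_of_lt hκ, add_zero]

theorem vertex_decode (K L z : ℕ) :
    vertex K L (z / (L + 1) / K) (z / (L + 1) % K) (z % (L + 1)) = z := by
  unfold vertex
  rw [Nat.div_add_mod', Nat.div_add_mod']

theorem vertex_inj {K L v κ t v' κ' t' : ℕ} (hκ : κ < K) (ht : t ≤ L) (hκ' : κ' < K)
    (ht' : t' ≤ L) (h : vertex K L v κ t = vertex K L v' κ' t') : v = v' ∧ κ = κ' ∧ t = t' := by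
  refine ⟨?_, ?_, ?_⟩
  · rw [← vertex_div_div (v := v) hκ ht, h, vertex_div_div hκ' ht']
  · rw [← vertex_div_mod (v := v) hκ ht, h, vertex_div_mod hκ' ht']
  · rw [← vertex_mod (K := K) (v := v) (κ := κ) ht, h, vertex_mod ht']

theorem exists_vertex {K X L z : ℕ} (hz : z < order K X L) :
    ∃ v κ t, v < X ∧ κ < K ∧ t ≤ L ∧ z = vertex K L v κ t := by
  have hK : 0 < K := by
    rcases Nat.eq_zero_or_pos K with h | h
    · simp [order, h] at hz
    · exact h
  refine ⟨z / (L + 1) / K, z / (L + 1) % K, z % (L + 1), ?_, Nat.mod_lt _ hK,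
    Nat.lt_succ_iff.mp (Nat.mod_lt _ (Nat.succ_pos L)), (vertex_decode K L z).symm⟩
  rw [Nat.div_div_eq_div_mul]
  apply Nat.div_lt_of_lt_mul
  unfold order at hz
  calc z < X * K * (L + 1) := hz
    _ = (L + 1) * K * X := by ring

/-! ### Upper bounds for distances -/

/-- In the incidence graph there is a walk of length at most `n` between the vertices numbered
`a` and `b`. -/
def Near (K X L : ℕ) (I : ℕ → ℕ → Prop) (n a b : ℕ) : Prop :=
  ∃ (ha : a < order K X L) (hb : b < order K X L) (p : (graph K X L I).Walk ⟨a, ha⟩ ⟨b, hb⟩),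
    p.length ≤ n

section Near

variable {K X L : ℕ} {I : ℕ → ℕ → Prop} {n n' a b c : ℕ}

theorem Near.refl (ha : a < order K X L) : Near K X L I 0 a a :=
  ⟨ha, ha, .nil, le_rfl⟩

theorem Near.symm (h : Near K X L I n a b) : Near K X L I n b a := by
  obtain ⟨ha, hb, p, hp⟩ := h
  exact ⟨hb, ha, p.reverse, by simpa using hp⟩

theorem Near.trans (h : Near K X L I n a b) (h' : Near K X L I n' b c) :
    Near K X L I (n + n') a c := by
  obtain ⟨ha, hb, p, hp⟩ := h
  obtain ⟨_, hc, q, hq⟩ := h'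
  exact ⟨ha, hc, p.append q, by rw [SimpleGraph.Walk.length_append]; omega⟩

theorem Near.mono (h : Near K X L I n a b) (hn : n ≤ n') : Near K X L I n' a b := by
  obtain ⟨ha, hb, p, hp⟩ := h
  exact ⟨ha, hb, p, hp.trans hn⟩

theorem Near.of_link (h : Link K L I a b) (ha : a < order K X L) (hb : b < order K X L) :
    Near K X L I 1 a b := by
  by_cases hab : a = b
  · subst hab
    exact (Near.refl ha).mono (Nat.zero_le 1)
  · have hadj : (graph K X L I).Adj ⟨a, ha⟩ ⟨b, hb⟩ := by
      rw [graph, SimpleGraph.fromRel_adj]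
      exact ⟨by simpa using hab, Or.inl h⟩
    exact ⟨ha, hb, SimpleGraph.Walk.cons hadj .nil, le_rfl⟩

theorem near_path {v κ t s : ℕ} (hv : v < X) (hκ : κ < K) (h : t + s ≤ L)
    (hI : t + s = L → s ≠ 0 → I v κ) :
    Near K X L I s (vertex K L v κ t) (vertex K L v κ (t + s)) := by
  induction s with
  | zero => exact Near.refl (vertex_lt hv hκ (by omega))
  | succ s ih =>
    refine (ih (by omega) (by omega)).trans ?_
    exact Near.of_link (Link.path v κ (t + s) hκ (by omega) fun h' => hI h' (by omega))
      (vertex_lt hv hκ (by omega)) (vertex_lt hv hκ (by omega))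

/-- The path of an incident pair leads from the tree to the spine. -/
theorem near_tree_spine {v κ : ℕ} (hv : v < X) (hκ : κ < K) (hI : I v κ) :
    Near K X L I L (vertex K L v κ 0) (vertex K L v κ L) := by
  simpa using near_path (t := 0) (s := L) hv hκ (by omega) (fun _ _ => hI)

theorem near_spine_add {v κ s : ℕ} (hv : v < X) (hκ : κ + s < K) :
    Near K X L I s (vertex K L v κ L) (vertex K L v (κ + s) L) := by
  induction s with
  | zero => exact Near.refl (vertex_lt hv hκ le_rfl)
  | succ s ih =>
    exact (ih (by omega)).trans (Near.of_link (Link.spine v (κ + s) (by omega))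
      (vertex_lt hv (by omega) le_rfl) (vertex_lt hv (by omega) le_rfl))

theorem near_spine {v κ κ' : ℕ} (hv : v < X) (hκ : κ < K) (hκ' : κ' < K) :
    Near K X L I K (vertex K L v κ L) (vertex K L v κ' L) := by
  rcases le_total κ κ' with h | h
  · obtain ⟨s, rfl⟩ := Nat.exists_eq_add_of_le h
    exact (near_spine_add hv hκ').mono (by omega)
  · obtain ⟨s, rfl⟩ := Nat.exists_eq_add_of_le h
    exact (near_spine_add hv hκ).symm.mono (by omega)

theorem near_root {κ d : ℕ} (hκ : κ < K) : ∀ {v : ℕ}, v < X → v < 2 ^ d →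
    Near K X L I d (vertex K L v κ 0) (vertex K L 0 κ 0) := by
  induction d with
  | zero =>
    intro v hv hd
    obtain rfl : v = 0 := by simpa using hd
    exact Near.refl (vertex_lt hv hκ (Nat.zero_le L))
  | succ d ih =>
    intro v hv hd
    have hlt : v / 2 < X := lt_of_le_of_lt (Nat.div_le_self v 2) hv
    by_cases h0 : v = 0
    · subst h0
      exact (Near.refl (vertex_lt hv hκ (Nat.zero_le L))).mono (Nat.zero_le _)
    · have h1 := Near.of_link (X := X) (Link.tree (L := L) (I := I) v κ hκ h0)
        (vertex_lt hv hκ (Nat.zero_le L)) (vertex_lt hlt hκ (Nat.zero_le L))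
      exact (h1.trans (ih hlt (by rw [pow_succ] at hd; omega))).mono (by omega)

theorem near_tree {κ d v w : ℕ} (hκ : κ < K) (hX : X ≤ 2 ^ d) (hv : v < X) (hw : w < X) :
    Near K X L I (2 * d) (vertex K L v κ 0) (vertex K L w κ 0) :=
  ((near_root hκ hv (hv.trans_le hX)).trans (near_root hκ hw (hw.trans_le hX)).symm).mono
    (by omega)

theorem Near.dist_le {p q : Fin (order K X L)} (h : Near K X L I n p q) :
    (graph K X L I).dist p q ≤ n := by
  obtain ⟨_, _, r, hr⟩ := h
  exact (SimpleGraph.dist_le r).trans hr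

/-- The spines of two vectors that share a coordinate. -/
theorem near_spine_of_inter {d v w κ κ₁ κ₂ : ℕ} (hX : X ≤ 2 ^ d) (hv : v < X) (hw : w < X)
    (hκ : κ < K) (hvκ : I v κ) (hwκ : I w κ) (h₁ : κ₁ < K) (h₂ : κ₂ < K) :
    Near K X L I (2 * L + 2 * K + 2 * d) (vertex K L v κ₁ L) (vertex K L w κ₂ L) :=
  (((((near_spine hv h₁ hκ).trans (near_tree_spine hv hκ hvκ).symm).trans
    (near_tree hκ hX hv hw)).trans (near_tree_spine hw hκ hwκ)).trans
    (near_spine hw hκ h₂)).mono (by omega)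

/-- Two trees are joined through a vector `0` which contains all coordinates. -/
theorem near_tree_tree {d v w κ κ' : ℕ} (hX : X ≤ 2 ^ d) (h0 : ∀ κ < K, I 0 κ) (hv : v < X)
    (hw : w < X) (hκ : κ < K) (hκ' : κ' < K) :
    Near K X L I (2 * L + K + 2 * d) (vertex K L v κ 0) (vertex K L w κ' 0) := by
  have hX0 : 0 < X := by omega
  exact (((((near_root hκ hv (hv.trans_le hX)).trans (near_tree_spine hX0 hκ (h0 κ hκ))).trans
    (near_spine hX0 hκ hκ')).trans (near_tree_spine hX0 hκ' (h0 κ' hκ')).symm).trans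
    (near_root hκ' hw (hw.trans_le hX)).symm).mono (by omega)

end Near

/-! ### The graph is hyperbolic if no unexpected pair of vectors is disjoint -/

/-- A vertex is low if it is within `ℓ` of a tree, where paths have length `2 * ℓ`. -/
def Low (K X ℓ : ℕ) (I : ℕ → ℕ → Prop) (z : ℕ) : Prop :=
  ∃ v κ, v < X ∧ κ < K ∧ Near K X (2 * ℓ) I ℓ z (vertex K (2 * ℓ) v κ 0)

/-- A vertex is high for the vector `v` if it is within `ℓ` of the spine of `v`. -/
def High (K X ℓ : ℕ) (I : ℕ → ℕ → Prop) (v z : ℕ) : Prop :=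
  v < X ∧ ∃ κ, κ < K ∧ Near K X (2 * ℓ) I ℓ z (vertex K (2 * ℓ) v κ (2 * ℓ))

section Hyperbolic

variable {K X ℓ d : ℕ} {I : ℕ → ℕ → Prop}

theorem low_or_high {z : ℕ} (hz : z < order K X (2 * ℓ)) :
    Low K X ℓ I z ∨ ∃ v, High K X ℓ I v z := by
  obtain ⟨v, κ, t, hv, hκ, ht, rfl⟩ := exists_vertex hz
  by_cases h1 : t = 2 * ℓ
  · exact Or.inr ⟨v, hv, κ, hκ, h1 ▸ (Near.refl hz).mono (Nat.zero_le _)⟩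
  by_cases h2 : t ≤ ℓ
  · refine Or.inl ⟨v, κ, hv, hκ, ?_⟩
    have := near_path (K := K) (X := X) (L := 2 * ℓ) (I := I) (t := 0) (s := t) hv hκ (by omega)
      (by omega)
    rw [zero_add] at this
    exact this.symm.mono h2
  by_cases hI : I v κ
  · refine Or.inr ⟨v, hv, κ, hκ, ?_⟩
    have := near_path (K := K) (X := X) (L := 2 * ℓ) (I := I) (t := t) (s := 2 * ℓ - t) hv hκ
      (by omega) (fun _ _ => hI)
    rw [Nat.add_sub_cancel' ht] at this
    exact this.mono (by omega)
  · refine Or.inl ⟨v, κ, hv, hκ, ?_⟩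
    have h3 := near_path (K := K) (X := X) (L := 2 * ℓ) (I := I) (t := t) (s := 2 * ℓ - 1 - t)
      hv hκ (by omega) (by omega)
    rw [Nat.add_sub_cancel' (by omega)] at h3
    exact (h3.trans (Near.of_link (Link.loop v κ hκ hI) (vertex_lt hv hκ (by omega))
      (vertex_lt hv hκ (by omega)))).mono (by omega)

/-- Every vertex is within `L + K` of some tree. -/
theorem near_some_tree (hI : ∀ v < X, ∃ κ < K, I v κ) {z : ℕ} (hz : z < order K X (2 * ℓ)) :
    ∃ v κ, v < X ∧ κ < K ∧ Near K X (2 * ℓ) I (2 * ℓ + K) z (vertex K (2 * ℓ) v κ 0) := by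
  obtain ⟨v, κ, t, hv, hκ, ht, rfl⟩ := exists_vertex hz
  by_cases h1 : t = 2 * ℓ
  · obtain ⟨κ', hκ', hI'⟩ := hI v hv
    refine ⟨v, κ', hv, hκ', ?_⟩
    rw [h1]
    exact ((near_spine hv hκ hκ').trans (near_tree_spine hv hκ' hI').symm).mono (by omega)
  · refine ⟨v, κ, hv, hκ, ?_⟩
    have := near_path (K := K) (X := X) (L := 2 * ℓ) (I := I) (t := 0) (s := t) hv hκ (by omega)
      (by omega)
    rw [zero_add] at this
    exact this.symm.mono (by omega)

theorem Low.near (hX : X ≤ 2 ^ d) (h0 : ∀ κ < K, I 0 κ) (hI : ∀ v < X, ∃ κ < K, I v κ)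
    {y z : ℕ} (hy : Low K X ℓ I y) (hz : z < order K X (2 * ℓ)) :
    Near K X (2 * ℓ) I (7 * ℓ + 2 * K + 2 * d) y z := by
  obtain ⟨v, κ, hv, hκ, h⟩ := hy
  obtain ⟨w, κ', hw, hκ', h'⟩ := near_some_tree hI hz
  exact ((h.trans (near_tree_tree hX h0 hv hw hκ hκ')).trans h'.symm).mono (by omega)

theorem High.near {v y z : ℕ} (hy : High K X ℓ I v y) (hz : High K X ℓ I v z) :
    Near K X (2 * ℓ) I (2 * ℓ + K) y z := by
  obtain ⟨hv, κ, hκ, h⟩ := hy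
  obtain ⟨_, κ', hκ', h'⟩ := hz
  exact ((h.trans (near_spine hv hκ hκ')).trans h'.symm).mono (by omega)

theorem High.near_of_inter (hX : X ≤ 2 ^ d) {v w y z : ℕ} (hy : High K X ℓ I v y)
    (hz : High K X ℓ I w z) (h : ∃ κ < K, I v κ ∧ I w κ) :
    Near K X (2 * ℓ) I (6 * ℓ + 2 * K + 2 * d) y z := by
  obtain ⟨hv, κ₁, h₁, hn⟩ := hy
  obtain ⟨hw, κ₂, h₂, hn'⟩ := hz
  obtain ⟨κ, hκ, hvκ, hwκ⟩ := h
  exact ((hn.trans (near_spine_of_inter hX hv hw hκ hvκ hwκ h₁ h₂)).trans hn'.symm).mono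
    (by omega)

/-- If `c` and `e` are the only vectors with disjoint supports, then every pair of vertices is
within `7 * ℓ` up to lower order terms, or it is close to the spines of `c` and `e`. -/
theorem near_or_high (hX : X ≤ 2 ^ d) (h0 : ∀ κ < K, I 0 κ) (hI : ∀ v < X, ∃ κ < K, I v κ)
    {c e : ℕ} (hinter : ∀ v < X, ∀ w < X, v ≠ w → (∀ κ < K, ¬ (I v κ ∧ I w κ)) →
      v = c ∧ w = e ∨ v = e ∧ w = c)
    {y z : ℕ} (hy : y < order K X (2 * ℓ)) (hz : z < order K X (2 * ℓ)) :
    Near K X (2 * ℓ) I (7 * ℓ + 2 * K + 2 * d) y z ∨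
      (High K X ℓ I c y ∧ High K X ℓ I e z) ∨ (High K X ℓ I e y ∧ High K X ℓ I c z) := by
  -- Only two high vertices of disjoint vectors can be far apart.
  rcases low_or_high (I := I) hy with h | ⟨v, hv⟩
  · exact Or.inl (h.near hX h0 hI hz)
  rcases low_or_high (I := I) hz with h | ⟨w, hw⟩
  · exact Or.inl (h.near hX h0 hI hy).symm
  by_cases hvw : v = w
  · subst hvw
    exact Or.inl ((hv.near hw).mono (by omega))
  by_cases hdis : ∃ κ < K, I v κ ∧ I w κ
  · exact Or.inl ((hv.near_of_inter hX hw hdis).mono (by omega))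
  · push Not at hdis
    rcases hinter v hv.1 w hw.1 hvw (fun κ hκ h => hdis κ hκ h.1 h.2) with ⟨rfl, rfl⟩ | ⟨rfl, rfl⟩
    · exact Or.inr (Or.inl ⟨hv, hw⟩)
    · exact Or.inr (Or.inr ⟨hv, hw⟩)

theorem connected (hX0 : 0 < X) (hK : 0 < K) (h0 : ∀ κ < K, I 0 κ)
    (hI : ∀ v < X, ∃ κ < K, I v κ) : (graph K X (2 * ℓ) I).Connected := by
  have hpos : 0 < order K X (2 * ℓ) := by unfold order; positivity
  have : Nonempty (Fin (order K X (2 * ℓ))) := ⟨⟨0, hpos⟩⟩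
  refine ⟨fun y z => ?_⟩
  obtain ⟨v, κ, hv, hκ, h⟩ := near_some_tree hI y.2
  obtain ⟨w, κ', hw, hκ', h'⟩ := near_some_tree hI z.2
  have hX : X ≤ 2 ^ X := Nat.lt_two_pow_self.le
  obtain ⟨_, _, p, _⟩ := (h.trans (near_tree_tree hX h0 hv hw hκ hκ')).trans h'.symm
  exact ⟨p⟩

end Hyperbolic

section FourPoint

variable {V : Type*} {G : SimpleGraph V}

/-- The defect in the four-point condition is at most the distance of a pair in the first sum. -/
theorem four_point_of_dist_le (hG : G.Connected) {δ : ℕ} {a b c e : V}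
    (h : G.dist a b ≤ δ ∨ G.dist c e ≤ δ) :
    G.dist a b + G.dist c e ≤
      max (G.dist a c + G.dist b e) (G.dist a e + G.dist b c) + δ := by
  have h1 : G.dist a b ≤ G.dist a c + G.dist b c :=
    G.dist_comm (u := c) (v := b) ▸ hG.dist_triangle
  have h2 : G.dist a b ≤ G.dist a e + G.dist b e :=
    G.dist_comm (u := e) (v := b) ▸ hG.dist_triangle
  have h3 : G.dist c e ≤ G.dist a c + G.dist a e :=
    G.dist_comm (u := a) (v := c) ▸ hG.dist_triangle
  have h4 : G.dist c e ≤ G.dist b c + G.dist b e :=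
    G.dist_comm (u := b) (v := c) ▸ hG.dist_triangle
  omega

/-- The defect in the four-point condition is at most twice the distance of a pair that the first
sum separates. -/
theorem four_point_of_two_mul_dist_le (hG : G.Connected) {δ : ℕ} {a b c e : V}
    (h : 2 * G.dist a c ≤ δ ∨ 2 * G.dist a e ≤ δ) :
    G.dist a b + G.dist c e ≤
      max (G.dist a c + G.dist b e) (G.dist a e + G.dist b c) + δ := by
  have h1 : G.dist a b ≤ G.dist a c + G.dist b c :=
    G.dist_comm (u := c) (v := b) ▸ hG.dist_triangle
  have h2 : G.dist a b ≤ G.dist a e + G.dist b e :=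
    G.dist_comm (u := e) (v := b) ▸ hG.dist_triangle
  have h3 : G.dist c e ≤ G.dist a c + G.dist a e :=
    G.dist_comm (u := a) (v := c) ▸ hG.dist_triangle
  omega

end FourPoint

theorem isHyperbolic {K X ℓ d : ℕ} {I : ℕ → ℕ → Prop} (hX : X ≤ 2 ^ d) (hX0 : 0 < X) (hK : 0 < K)
    (h0 : ∀ κ < K, I 0 κ) (hI : ∀ v < X, ∃ κ < K, I v κ) (c e : ℕ)
    (hinter : ∀ v < X, ∀ w < X, v ≠ w → (∀ κ < K, ¬ (I v κ ∧ I w κ)) →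
      v = c ∧ w = e ∨ v = e ∧ w = c) :
    (graph K X (2 * ℓ) I).IsHyperbolic (7 * ℓ + 2 * K + 2 * d) := by
  intro p q r s
  have hconn := connected (ℓ := ℓ) hX0 hK h0 hI
  rcases near_or_high (ℓ := ℓ) hX h0 hI hinter p.2 q.2 with h | h
  · exact four_point_of_dist_le hconn (Or.inl h.dist_le)
  rcases near_or_high (ℓ := ℓ) hX h0 hI hinter r.2 s.2 with h' | h'
  · exact four_point_of_dist_le hconn (Or.inr h'.dist_le)
  apply four_point_of_two_mul_dist_le hconn
  rcases h with ⟨hp, hq⟩ | ⟨hp, hq⟩ <;> rcases h' with ⟨hr, hs⟩ | ⟨hr, hs⟩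
  · have := (hp.near hr).dist_le; omega
  · have := (hp.near hs).dist_le; omega
  · have := (hp.near hs).dist_le; omega
  · have := (hp.near hr).dist_le; omega

/-! ### The graph is not hyperbolic if an additional pair of vectors is disjoint -/

section Potential

variable {K X L : ℕ} {I : ℕ → ℕ → Prop}

open Classical in
/-- The potential of the tree of `κ` with respect to the vector `v`. -/
noncomputable def treePotential (L : ℕ) (I : ℕ → ℕ → Prop) (v κ : ℕ) : ℤ := if I v κ then L else 3 * L

open Classical in
/-- The potential of the spine of `w` with respect to the vector `v`. -/
noncomputable def spinePotential (K L : ℕ) (I : ℕ → ℕ → Prop) (v w : ℕ) : ℤ :=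
  if w = v then 0 else if ∃ κ < K, I v κ ∧ I w κ then 2 * L else 4 * L

open Classical in
/-- A lower bound for the distance from the spine of `v`. On the path of an incident pair it
interpolates between the potentials of the tree and of the spine. -/
noncomputable def potential (K L : ℕ) (I : ℕ → ℕ → Prop) (v w κ t : ℕ) : ℤ :=
  if t = L then spinePotential K L I v w
  else if I w κ then
    if treePotential L I v κ < spinePotential K L I v w then treePotential L I v κ + t
    else treePotential L I v κ - t
  else treePotential L I v κ

theorem treePotential_spinePotential {v w κ : ℕ} (hκ : κ < K) (h : I w κ) :
    spinePotential K L I v w = treePotential L I v κ + L ∨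
      spinePotential K L I v w = treePotential L I v κ - L := by
  unfold treePotential spinePotential
  by_cases h1 : w = v
  · subst h1
    simp [h]
  · by_cases h2 : I v κ
    · have h3 : ∃ κ < K, I v κ ∧ I w κ := ⟨κ, hκ, h2, h⟩
      rw [if_neg h1, if_pos h3, if_pos h2]
      left; ring
    · rw [if_neg h1, if_neg h2]
      split_ifs
      · right; ring
      · left; ring

theorem potential_zero (hL : 0 < L) (v w κ : ℕ) :
    potential K L I v w κ 0 = treePotential L I v κ := by
  unfold potential
  rw [if_neg (by omega)]
  split_ifs <;> simp

/-- The potential is `1`-Lipschitz. -/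
theorem Link.potential_le (hL : 0 < L) (v : ℕ) {a b : ℕ} (h : Link K L I a b) :
    |potential K L I v (a / (L + 1) / K) (a / (L + 1) % K) (a % (L + 1)) -
      potential K L I v (b / (L + 1) / K) (b / (L + 1) % K) (b % (L + 1))| ≤ 1 := by
  cases h with
  | tree w κ hκ hw =>
    rw [vertex_div_div hκ (by omega), vertex_div_mod hκ (by omega), vertex_mod (by omega),
      vertex_div_div hκ (by omega), vertex_div_mod hκ (by omega), vertex_mod (by omega),
      potential_zero hL, potential_zero hL]
    simp
  | path w κ t hκ ht hI =>
    rw [vertex_div_div hκ (by omega), vertex_div_mod hκ (by omega), vertex_mod (by omega),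
      vertex_div_div hκ (by omega), vertex_div_mod hκ (by omega), vertex_mod (by omega)]
    unfold potential
    rw [if_neg ht.ne]
    by_cases h1 : I w κ
    · simp only [if_pos h1]
      rcases treePotential_spinePotential (L := L) (v := v) hκ h1 with h2 | h2
      · simp only [show treePotential L I v κ < spinePotential K L I v w by omega, if_true]
        split_ifs with h3
        · rw [h2, abs_le]; omega
        · rw [abs_le]; push_cast; omega
      · simp only [show ¬ treePotential L I v κ < spinePotential K L I v w by omega, if_false]
        split_ifs with h3
        · rw [h2, abs_le]; omega
        · rw [abs_le]; push_cast; omega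
    · simp [h1, show t + 1 ≠ L from fun h => h1 (hI h)]
  | loop w κ hκ hI =>
    rw [vertex_div_div hκ (by omega), vertex_div_mod hκ (by omega), vertex_mod (by omega),
      vertex_div_div hκ (by omega), vertex_div_mod hκ (by omega), vertex_mod (by omega),
      potential_zero hL]
    unfold potential
    rw [if_neg (by omega), if_neg hI]
    simp
  | spine w κ hκ =>
    rw [vertex_div_div (by omega) le_rfl, vertex_div_mod (by omega) le_rfl, vertex_mod le_rfl,
      vertex_div_div hκ le_rfl, vertex_div_mod hκ le_rfl, vertex_mod le_rfl]
    simp [potential]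

theorem le_dist_of_disjoint (hconn : (graph K X L I).Connected) (hL : 0 < L) {v w : ℕ}
    (hvw : v ≠ w) (hdis : ∀ κ < K, ¬ (I v κ ∧ I w κ)) {p q : Fin (order K X L)} {κ κ' : ℕ}
    (hκ : κ < K) (hκ' : κ' < K)
    (hp : (p : ℕ) = vertex K L v κ L) (hq : (q : ℕ) = vertex K L w κ' L) :
    4 * L ≤ (graph K X L I).dist p q := by
  let F : ℕ → ℤ := fun a => potential K L I v (a / (L + 1) / K) (a / (L + 1) % K) (a % (L + 1))
  have hwalk : ∀ (x y : Fin (order K X L)) (r : (graph K X L I).Walk x y),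
      |F x - F y| ≤ r.length := by
    intro x y r
    induction r with
    | nil => simp
    | @cons x y z hadj r ih =>
      have h1 : |F x - F y| ≤ 1 := by
        rw [graph, SimpleGraph.fromRel_adj] at hadj
        rcases hadj.2 with h | h
        · exact h.potential_le hL v
        · rw [abs_sub_comm]; exact h.potential_le hL v
      have h2 := abs_sub_le (F x) (F y) (F z)
      rw [SimpleGraph.Walk.length_cons]
      push_cast
      linarith
  obtain ⟨r, hr⟩ := hconn.exists_walk_length_eq_dist p q
  have h := hwalk p q r
  have hFp : F p = 0 := by
    simp only [F, hp]
    rw [vertex_div_div hκ le_rfl, vertex_mod le_rfl]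
    simp [potential, spinePotential]
  have hFq : F q = 4 * L := by
    simp only [F, hq]
    rw [vertex_div_div hκ' le_rfl, vertex_mod le_rfl]
    simp only [potential, spinePotential, if_true]
    rw [if_neg hvw.symm, if_neg]
    rintro ⟨κ, hκ, h⟩
    exact hdis κ hκ h
  rw [hr, hFp, hFq, abs_le] at h
  omega

end Potential

theorem not_isHyperbolic {K X ℓ d : ℕ} {I : ℕ → ℕ → Prop} (hX : X ≤ 2 ^ d) (hK : 0 < K)
    (hℓ : 6 * K + 6 * d < ℓ) (h0 : ∀ κ < K, I 0 κ) (hI : ∀ v < X, ∃ κ < K, I v κ) {a b c e : ℕ}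
    (ha : a < X) (hb : b < X) (hc : c < X) (he : e < X) (hab : a ≠ b) (hce : c ≠ e)
    (hdab : ∀ κ < K, ¬ (I a κ ∧ I b κ)) (hdce : ∀ κ < K, ¬ (I c κ ∧ I e κ))
    (hac : ∃ κ < K, I a κ ∧ I c κ) (hae : ∃ κ < K, I a κ ∧ I e κ)
    (hbc : ∃ κ < K, I b κ ∧ I c κ) (hbe : ∃ κ < K, I b κ ∧ I e κ) :
    ¬ (graph K X (2 * ℓ) I).IsHyperbolic (7 * ℓ + 2 * K + 2 * d) := by
  intro h
  have hconn := connected (ℓ := ℓ) (by omega) hK h0 hI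
  let pt : ∀ v, v < X → Fin (order K X (2 * ℓ)) := fun v hv =>
    ⟨vertex K (2 * ℓ) v 0 (2 * ℓ), vertex_lt hv hK le_rfl⟩
  have far : ∀ {v w : ℕ} (hv : v < X) (hw : w < X), v ≠ w → (∀ κ < K, ¬ (I v κ ∧ I w κ)) →
      8 * ℓ ≤ (graph K X (2 * ℓ) I).dist (pt v hv) (pt w hw) := by
    intro v w hv hw hvw hdis
    have := le_dist_of_disjoint hconn (by omega) hvw hdis hK hK
      (p := pt v hv) (q := pt w hw) rfl rfl
    omega
  have close : ∀ {v w : ℕ} (hv : v < X) (hw : w < X), (∃ κ < K, I v κ ∧ I w κ) →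
      (graph K X (2 * ℓ) I).dist (pt v hv) (pt w hw) ≤ 4 * ℓ + 2 * K + 2 * d := by
    rintro v w hv hw ⟨κ, hκ, h1, h2⟩
    have := (near_spine_of_inter (L := 2 * ℓ) hX hv hw hκ h1 h2 hK hK)
    exact (Near.dist_le (p := pt v hv) (q := pt w hw) this).trans (by omega)
  have h' := h (pt a ha) (pt b hb) (pt c hc) (pt e he)
  have := far ha hb hab hdab
  have := far hc he hce hdce
  have := close ha hc hac
  have := close ha he hae
  have := close hb hc hbc
  have := close hb he hbe
  omega

/-! ### Maximum degree and edge list of the incidence graph -/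

section EdgeList

variable {K X L : ℕ} {I : ℕ → ℕ → Prop}

theorem Link.lt {a b : ℕ} (h : Link K L I a b) (ha : a < order K X L) : b < order K X L := by
  obtain ⟨v', κ', t', hv', hκ', ht', rfl⟩ := exists_vertex ha
  generalize hz : vertex K L v' κ' t' = z at h
  cases h with
  | tree v κ hκ hv =>
    obtain ⟨rfl, rfl, rfl⟩ := vertex_inj hκ' ht' hκ (by omega) hz
    exact vertex_lt (by omega) hκ (by omega)
  | path v κ t hκ ht hI =>
    obtain ⟨rfl, rfl, rfl⟩ := vertex_inj hκ' ht' hκ (by omega) hz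
    exact vertex_lt hv' hκ (by omega)
  | loop v κ hκ hI =>
    obtain ⟨rfl, rfl, rfl⟩ := vertex_inj hκ' ht' hκ (by omega) hz
    exact vertex_lt hv' hκ (by omega)
  | spine v κ hκ =>
    obtain ⟨rfl, rfl, rfl⟩ := vertex_inj hκ' ht' (by omega) (by omega) hz
    exact vertex_lt hv' hκ (by omega)

theorem Link.ne (hL : 3 ≤ L) {a b : ℕ} (h : Link K L I a b) : a ≠ b := by
  intro hab
  cases h with
  | tree v κ hκ hv =>
    have := (vertex_inj hκ (by omega) hκ (by omega) hab).1
    omega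
  | path v κ t hκ ht hI =>
    have := (vertex_inj hκ (by omega) hκ (by omega) hab).2.2
    omega
  | loop v κ hκ hI =>
    have := (vertex_inj hκ (by omega) hκ (by omega) hab).2.2
    omega
  | spine v κ hκ =>
    have := (vertex_inj (by omega) (by omega) hκ (by omega) hab).2.1
    omega

theorem vertex_add_one (v κ t : ℕ) : vertex K L v κ (t + 1) = vertex K L v κ t + 1 := rfl

theorem vertex_coord_add_one (v κ t : ℕ) :
    vertex K L v (κ + 1) t = vertex K L v κ t + (L + 1) := by
  unfold vertex; ring

/-- Five numbers among which the neighbours of the vertex `v`, `κ`, `t` are. -/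
def neighbours (K L v κ t : ℕ) : Finset ℕ :=
  if t = 0 then {vertex K L (v / 2) κ 0, vertex K L v κ 1, vertex K L (2 * v) κ 0,
    vertex K L (2 * v + 1) κ 0, vertex K L v κ (L - 1)}
  else {vertex K L v κ t + 1, vertex K L v κ t - 1, vertex K L v κ t + (L + 1),
    vertex K L v κ t - (L + 1), vertex K L v κ 0}

theorem Link.mem_neighbours (hL : 3 ≤ L) {v κ t y : ℕ} (hκ : κ < K) (ht : t ≤ L)
    (h : Link K L I (vertex K L v κ t) y) : y ∈ neighbours K L v κ t := by
  generalize hz : vertex K L v κ t = z at h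
  unfold neighbours
  cases h with
  | tree v' κ' hκ' hv =>
    obtain ⟨rfl, rfl, rfl⟩ := vertex_inj hκ ht hκ' (by omega) hz
    simp
  | path v' κ' t' hκ' ht' hI =>
    obtain ⟨rfl, rfl, rfl⟩ := vertex_inj hκ ht hκ' (by omega) hz
    split_ifs with h0
    · subst h0; simp
    · simp [vertex_add_one]
  | loop v' κ' hκ' hI =>
    obtain ⟨rfl, rfl, rfl⟩ := vertex_inj hκ ht hκ' (by omega) hz
    rw [if_neg (by omega)]
    simp
  | spine v' κ' hκ' =>
    obtain ⟨rfl, rfl, rfl⟩ := vertex_inj hκ ht (by omega) (by omega) hz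
    rw [if_neg (by omega)]
    simp [vertex_coord_add_one]

theorem Link.mem_neighbours' (hL : 3 ≤ L) {v κ t y : ℕ} (hκ : κ < K) (ht : t ≤ L)
    (h : Link K L I y (vertex K L v κ t)) : y ∈ neighbours K L v κ t := by
  generalize hz : vertex K L v κ t = z at h
  unfold neighbours
  cases h with
  | tree v' κ' hκ' hv =>
    obtain ⟨rfl, rfl, rfl⟩ := vertex_inj hκ ht hκ' (by omega) hz
    rcases Nat.even_or_odd' v' with ⟨c, rfl | rfl⟩
    · rw [show 2 * c / 2 = c by omega]; simp
    · rw [show (2 * c + 1) / 2 = c by omega]; simp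
  | path v' κ' t' hκ' ht' hI =>
    obtain ⟨rfl, rfl, rfl⟩ := vertex_inj hκ ht hκ' (by omega) hz
    rw [if_neg (by omega)]
    simp [vertex_add_one]
  | loop v' κ' hκ' hI =>
    obtain ⟨rfl, rfl, rfl⟩ := vertex_inj hκ ht hκ' (by omega) hz
    simp
  | spine v' κ' hκ' =>
    obtain ⟨rfl, rfl, rfl⟩ := vertex_inj hκ ht (by omega) (by omega) hz
    rw [if_neg (by omega)]
    simp [vertex_coord_add_one]

theorem maxDegree_le (hL : 3 ≤ L) [DecidableRel (graph K X L I).Adj] :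
    (graph K X L I).maxDegree ≤ 5 := by
  apply SimpleGraph.maxDegree_le_of_forall_degree_le
  intro z
  obtain ⟨v, κ, t, hv, hκ, ht, hz⟩ := exists_vertex z.2
  rw [← SimpleGraph.card_neighborFinset_eq_degree,
    ← Finset.card_map (Fin.valEmbedding : Fin (order K X L) ↪ ℕ)]
  calc _ ≤ (neighbours K L v κ t).card := by
        apply Finset.card_le_card
        intro y hy
        rw [Finset.mem_map] at hy
        obtain ⟨y, hy, rfl⟩ := hy
        rw [SimpleGraph.mem_neighborFinset, graph, SimpleGraph.fromRel_adj, hz] at hy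
        rcases hy.2 with h | h
        · exact h.mem_neighbours hL hκ ht
        · exact h.mem_neighbours' hL hκ ht
    _ ≤ 5 := by
        unfold neighbours
        split_ifs <;> exact Finset.card_le_five

/-- The end of the directed edge from the vertex `z` along a path or a spine. -/
def next (K L : ℕ) (I : ℕ → ℕ → Prop) [DecidableRel I] (z : ℕ) : ℕ :=
  if z % (L + 1) = L then z + (L + 1)
  else if z % (L + 1) + 1 = L ∧ ¬ I (z / (L + 1) / K) (z / (L + 1) % K) then z + 1 - L
  else z + 1

/-- The enumeration of the directed edges: the number `2 * z` stands for the edge from `z` to its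
parent in a tree, and `2 * z + 1` for the edge from `z` to the next vertex on a path or a spine,
if there are such edges. -/
def edgeAt (K L : ℕ) (I : ℕ → ℕ → Prop) [DecidableRel I] (w : ℕ) : Option (ℕ × ℕ) :=
  if w % 2 = 0 then
    if w / 2 % (L + 1) = 0 ∧ w / 2 / (L + 1) / K ≠ 0 then
      some (w / 2, vertex K L (w / 2 / (L + 1) / K / 2) (w / 2 / (L + 1) % K) 0)
    else none
  else
    if w / 2 % (L + 1) = L ∧ w / 2 / (L + 1) % K + 1 = K then none
    else some (w / 2, next K L I (w / 2))

variable [DecidableRel I]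

theorem link_next (hK : 0 < K) {z : ℕ}
    (hz : ¬ (z % (L + 1) = L ∧ z / (L + 1) % K + 1 = K)) :
    Link K L I z (next K L I z) ∧ next K L I z / (L + 1) / K = z / (L + 1) / K := by
  have hκ : z / (L + 1) % K < K := Nat.mod_lt _ hK
  have ht : z % (L + 1) ≤ L := Nat.lt_succ_iff.mp (Nat.mod_lt _ (Nat.succ_pos L))
  have hdec := vertex_decode K L z
  generalize z / (L + 1) / K = v at *
  generalize z / (L + 1) % K = κ at *
  generalize z % (L + 1) = t at *
  unfold next
  rw [← hdec, vertex_mod ht, vertex_div_mod hκ ht, vertex_div_div hκ ht]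
  split_ifs with h1 h2
  · subst h1
    have hκ' : κ + 1 < K := by omega
    rw [← vertex_coord_add_one, vertex_div_div hκ' le_rfl]
    exact ⟨Link.spine v κ hκ', rfl⟩
  · have h3 : vertex K L v κ t + 1 - L = vertex K L v κ 0 := by unfold vertex; omega
    rw [h3, vertex_div_div hκ (by omega), show t = L - 1 by omega]
    exact ⟨Link.loop v κ hκ h2.2, rfl⟩
  · rw [← vertex_add_one, vertex_div_div hκ (by omega)]
    exact ⟨Link.path v κ t hκ (by omega) (by tauto), rfl⟩

/-- The meaning of `edgeAt`, together with the facts which tell apart the two kinds of edges. -/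
theorem edgeAt_eq_some (hK : 0 < K) {w a b : ℕ} (h : edgeAt K L I w = some (a, b)) :
    a = w / 2 ∧ Link K L I a b ∧
      ((w % 2 = 0 ∧ a / (L + 1) / K ≠ 0 ∧ b / (L + 1) / K = a / (L + 1) / K / 2) ∨
        (w % 2 = 1 ∧ b / (L + 1) / K = a / (L + 1) / K ∧ b = next K L I a)) := by
  unfold edgeAt at h
  split_ifs at h with h1 h2 h2
  · simp only [Option.some.injEq, Prod.mk.injEq] at h
    obtain ⟨rfl, rfl⟩ := h
    have hκ : w / 2 / (L + 1) % K < K := Nat.mod_lt _ hK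
    refine ⟨rfl, ?_, Or.inl ⟨h1, h2.2, vertex_div_div hκ (by omega)⟩⟩
    have := Link.tree (L := L) (I := I) _ _ hκ h2.2
    rwa [← h2.1, vertex_decode, h2.1] at this
  · simp only [Option.some.injEq, Prod.mk.injEq] at h
    obtain ⟨rfl, rfl⟩ := h
    have := link_next (I := I) hK h2
    exact ⟨rfl, this.1, Or.inr ⟨by omega, this.2, rfl⟩⟩

theorem exists_edgeAt (hL : 3 ≤ L) {a b : ℕ} (h : Link K L I a b) :
    ∃ w, w / 2 = a ∧ edgeAt K L I w = some (a, b) := by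
  cases h with
  | tree v κ hκ hv =>
    refine ⟨2 * vertex K L v κ 0, by omega, ?_⟩
    unfold edgeAt
    rw [if_pos (by omega), Nat.mul_div_cancel_left _ (by omega), vertex_mod (by omega),
      vertex_div_mod hκ (by omega), vertex_div_div hκ (by omega), if_pos ⟨rfl, hv⟩]
  | path v κ t hκ ht hI =>
    refine ⟨2 * vertex K L v κ t + 1, by omega, ?_⟩
    unfold edgeAt next
    rw [if_neg (by omega), show (2 * vertex K L v κ t + 1) / 2 = vertex K L v κ t by omega,
      vertex_mod (by omega), vertex_div_mod hκ (by omega), vertex_div_div hκ (by omega),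
      if_neg (by omega), if_neg (by omega), if_neg (by tauto), vertex_add_one]
  | loop v κ hκ hI =>
    refine ⟨2 * vertex K L v κ (L - 1) + 1, by omega, ?_⟩
    unfold edgeAt next
    rw [if_neg (by omega),
      show (2 * vertex K L v κ (L - 1) + 1) / 2 = vertex K L v κ (L - 1) by omega,
      vertex_mod (by omega), vertex_div_mod hκ (by omega), vertex_div_div hκ (by omega),
      if_neg (by omega), if_neg (by omega), if_pos ⟨by omega, hI⟩]
    congr 2
    unfold vertex; omega
  | spine v κ hκ =>
    refine ⟨2 * vertex K L v κ L + 1, by omega, ?_⟩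
    unfold edgeAt next
    rw [if_neg (by omega), show (2 * vertex K L v κ L + 1) / 2 = vertex K L v κ L by omega,
      vertex_mod (by omega), vertex_div_mod (by omega) (by omega),
      vertex_div_div (by omega) (by omega), if_neg (by omega), if_pos rfl, vertex_coord_add_one]

/-- No edge is listed twice, not even in different orientations. -/
theorem edgeAt_inj (hK : 0 < K) (hL : 3 ≤ L) {w w' a b a' b' : ℕ}
    (h : edgeAt K L I w = some (a, b)) (h' : edgeAt K L I w' = some (a', b'))
    (heq : s(a, b) = s(a', b')) : w = w' := by
  obtain ⟨h1, -, h2⟩ := edgeAt_eq_some hK h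
  obtain ⟨h1', -, h2'⟩ := edgeAt_eq_some hK h'
  rw [Sym2.eq_iff] at heq
  rcases heq with ⟨rfl, rfl⟩ | ⟨rfl, rfl⟩
  · generalize a / (L + 1) / K = va at *
    generalize b / (L + 1) / K = vb at *
    omega
  · generalize a / (L + 1) / K = va at *
    generalize b / (L + 1) / K = vb at *
    rcases h2 with h2 | ⟨h4, h2, h3⟩
    · omega
    · rcases h2' with h2' | ⟨h4', h2', h3'⟩
      · omega
      · have hm : ∀ z, z % (L + 1) ≤ z := fun z => Nat.mod_le _ _
        have := hm a
        have := hm b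
        unfold next at h3 h3'
        split_ifs at h3 h3' <;> omega

/-- The list of edges in the order of `edgeAt`. -/
def edges (K X L : ℕ) (I : ℕ → ℕ → Prop) [DecidableRel I] : List (ℕ × ℕ) :=
  (List.range (2 * order K X L)).filterMap (edgeAt K L I)

theorem mem_edges (hK : 0 < K) (hL : 3 ≤ L) {a b : ℕ} :
    (a, b) ∈ edges K X L I ↔ a < order K X L ∧ Link K L I a b := by
  unfold edges
  rw [List.mem_filterMap]
  constructor
  · rintro ⟨w, hw, h⟩
    obtain ⟨h1, h2, -⟩ := edgeAt_eq_some hK h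
    rw [List.mem_range] at hw
    exact ⟨by omega, h2⟩
  · rintro ⟨ha, h⟩
    obtain ⟨w, hw, h'⟩ := exists_edgeAt hL h
    exact ⟨w, List.mem_range.mpr (by omega), h'⟩

theorem exists_isEdgeList (hK : 0 < K) (hL : 3 ≤ L) :
    ∃ es : List (Fin (order K X L) × Fin (order K X L)), (graph K X L I).IsEdgeList es ∧
      es.map (fun e => ((e.1 : ℕ), (e.2 : ℕ))) = edges K X L I := by
  have hmem : ∀ e ∈ edges K X L I, e.1 < order K X L ∧ e.2 < order K X L := by
    rintro ⟨a, b⟩ he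
    obtain ⟨ha, h⟩ := (mem_edges hK hL).mp he
    exact ⟨ha, h.lt ha⟩
  let f : (e : ℕ × ℕ) → (e.1 < order K X L ∧ e.2 < order K X L) →
    Fin (order K X L) × Fin (order K X L) := fun e h => (⟨e.1, h.1⟩, ⟨e.2, h.2⟩)
  have hmap : ((edges K X L I).pmap f hmem).map (fun e => ((e.1 : ℕ), (e.2 : ℕ))) =
      edges K X L I := by
    rw [List.map_pmap]
    simp [f]
  refine ⟨(edges K X L I).pmap f hmem, ⟨?_, ?_⟩, hmap⟩
  · have hnodup : ((edges K X L I).map fun e => s(e.1, e.2)).Nodup := by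
      unfold edges
      rw [List.map_filterMap]
      refine List.Nodup.filterMap ?_ List.nodup_range
      intro w w' e he he'
      simp only [Option.mem_def, Option.map_eq_some_iff] at he he'
      obtain ⟨⟨a, b⟩, h, rfl⟩ := he
      obtain ⟨⟨a', b'⟩, h', heq⟩ := he'
      exact edgeAt_inj hK hL h h' heq.symm
    refine List.Nodup.of_map (Sym2.map Fin.val) ?_
    rw [List.map_map]
    rw [← hmap, List.map_map] at hnodup
    exact hnodup
  · intro e
    induction e using Sym2.ind with
    | _ a b =>
    rw [SimpleGraph.mem_edgeSet, graph, SimpleGraph.fromRel_adj, List.mem_map]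
    have hp : ∀ x y : Fin (order K X L), (x, y) ∈ (edges K X L I).pmap f hmem ↔
        Link K L I x y := by
      intro x y
      rw [List.mem_pmap]
      constructor
      · rintro ⟨⟨x', y'⟩, h, heq⟩
        simp only [f, Prod.mk.injEq] at heq
        obtain ⟨rfl, rfl⟩ := heq
        exact ((mem_edges hK hL).mp h).2
      · intro h
        exact ⟨(x, y), (mem_edges hK hL).mpr ⟨x.2, h⟩, rfl⟩
    constructor
    · rintro ⟨⟨x, y⟩, h, heq⟩
      rw [hp] at h
      rw [Sym2.eq_iff] at heq
      have hne := h.ne hL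
      rcases heq with ⟨rfl, rfl⟩ | ⟨rfl, rfl⟩
      · exact ⟨fun h => hne (congrArg _ h), Or.inl h⟩
      · exact ⟨fun h => hne (congrArg _ h.symm), Or.inr h⟩
    · rintro ⟨-, h | h⟩
      · exact ⟨(a, b), (hp a b).mpr h, rfl⟩
      · exact ⟨(b, a), (hp b a).mpr h, Sym2.eq_swap⟩

end EdgeList

end IncidenceGraph

/-! ### Straight-line programs with compound expressions -/

namespace RAM

/-- Arithmetic expressions in the registers. In `select c a b` the value is that of `a` or of `b`,
according to whether the value of `c` is nonzero or zero. -/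
inductive Expr
  | var (i : ℕ)
  | lit (c : ℕ)
  | op (o : Op) (a b : Expr)
  | select (c a b : Expr)

namespace Expr

instance : Add Expr := ⟨op .add⟩
instance : Sub Expr := ⟨op .sub⟩
instance : Mul Expr := ⟨op .mul⟩
instance : Div Expr := ⟨op .div⟩
instance (n : ℕ) : OfNat Expr n := ⟨lit n⟩

/-- The remainder. -/
instance : Mod Expr := ⟨fun a b => a - a / b * b⟩

/-- `eq a b` takes the value `1` if `a` and `b` have equal values, and `0` otherwise. -/
def eq (a b : Expr) : Expr := select ((a - b) + (b - a)) (lit 0) (lit 1)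

/-- The value of the expression if register `i` holds `ρ i`. -/
def eval (ρ : ℕ → ℕ) : Expr → ℕ
  | var i => ρ i
  | lit c => c
  | op o a b => o.eval (a.eval ρ) (b.eval ρ)
  | select c a b => if c.eval ρ = 0 then b.eval ρ else a.eval ρ

/-- A strict upper bound for the indices of the registers that occur in the expression. -/
def width : Expr → ℕ
  | var i => i + 1
  | lit _ => 0
  | op _ a b => max a.width b.width
  | select c a b => max c.width (max a.width b.width)

/-- The program that evaluates the expression into register `r`, with the help of the registers
above `r`, which have to be zero and which become zero again. -/
def compile (r : ℕ) : Expr → Prog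
  | var i => .arith .add r i (r + 1)
  | lit c => .const r c
  | op o a b => .seq (a.compile r) (.seq (b.compile (r + 1))
      (.seq (.arith o r r (r + 1)) (.const (r + 1) 0)))
  | select c a b => .seq (c.compile r) (.ite r (a.compile r) (b.compile r))

/-- A factor for the cost of the evaluation and for the size of the value. -/
def weight : Expr → ℕ
  | var _ => 1
  | lit c => 1 + c.size
  | op _ a b => 2 * a.weight + 2 * b.weight + 2
  | select c a b => 2 * c.weight + a.weight + b.weight + 1

section eval

-- The lemmas are proved by `id rfl` so that `simp` does not treat them as definitional rewrite rules,
-- which would leave the decidability instances in conditions behind.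

variable (ρ : ℕ → ℕ) (a b c : Expr)

@[simp] theorem eval_var (i : ℕ) : (var i).eval ρ = ρ i := id rfl
@[simp] theorem eval_lit (n : ℕ) : (lit n).eval ρ = n := id rfl
@[simp] theorem eval_ofNat (n : ℕ) : eval ρ (no_index (OfNat.ofNat n)) = n := id rfl
@[simp] theorem eval_add : (a + b).eval ρ = a.eval ρ + b.eval ρ := id rfl
@[simp] theorem eval_sub : (a - b).eval ρ = a.eval ρ - b.eval ρ := id rfl
@[simp] theorem eval_mul : (a * b).eval ρ = a.eval ρ * b.eval ρ := id rfl
@[simp] theorem eval_div : (a / b).eval ρ = a.eval ρ / b.eval ρ := id rfl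
@[simp] theorem eval_select :
    (select c a b).eval ρ = if c.eval ρ = 0 then b.eval ρ else a.eval ρ := id rfl

@[simp] theorem eval_mod : (a % b).eval ρ = a.eval ρ % b.eval ρ := by
  change a.eval ρ - a.eval ρ / b.eval ρ * b.eval ρ = _
  rw [Nat.mod_eq_sub, mul_comm]

@[simp] theorem eval_eq : (eq a b).eval ρ = if a.eval ρ = b.eval ρ then 1 else 0 := by
  simp only [eq, eval_select, eval_add, eval_sub, eval_lit]
  by_cases h : a.eval ρ = b.eval ρ
  · simp [h]
  · have h' : a.eval ρ - b.eval ρ + (b.eval ρ - a.eval ρ) ≠ 0 := by omega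
    rw [if_neg h', if_neg h]

end eval

theorem eval_congr {ρ ρ' : ℕ → ℕ} (e : Expr) (h : ∀ i < e.width, ρ i = ρ' i) :
    e.eval ρ = e.eval ρ' := by
  induction e with
  | var i => exact h i (Nat.lt_succ_self i)
  | lit c => rfl
  | op o a b iha ihb =>
    simp only [eval]
    rw [iha fun i hi => h i (lt_max_of_lt_left hi), ihb fun i hi => h i (lt_max_of_lt_right hi)]
  | select c a b ihc iha ihb =>
    simp only [eval]
    rw [ihc fun i hi => h i (lt_max_of_lt_left hi),
      iha fun i hi => h i (lt_max_of_lt_right (lt_max_of_lt_left hi)),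
      ihb fun i hi => h i (lt_max_of_lt_right (lt_max_of_lt_right hi))]

end Expr

theorem size_mono {a b : ℕ} (h : a ≤ b) : a.size ≤ b.size := Nat.size_le_size h

theorem size_add_le (a b : ℕ) : (a + b).size ≤ a.size + b.size + 1 := by
  rw [Nat.size_le]
  have ha := Nat.lt_size_self a
  have hb := Nat.lt_size_self b
  have h1 : 2 ^ a.size ≤ 2 ^ (a.size + b.size) := Nat.pow_le_pow_right (by omega) (by omega)
  have h2 : 2 ^ b.size ≤ 2 ^ (a.size + b.size) := Nat.pow_le_pow_right (by omega) (by omega)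
  rw [pow_succ]
  omega

theorem size_mul_le (a b : ℕ) : (a * b).size ≤ a.size + b.size := by
  rw [Nat.size_le, pow_add]
  exact Nat.mul_lt_mul'' (Nat.lt_size_self a) (Nat.lt_size_self b)

theorem Op.size_eval_le (o : Op) (a b : ℕ) : (o.eval a b).size ≤ a.size + b.size + 1 := by
  cases o
  · exact size_add_le a b
  · exact (size_mono (Nat.sub_le a b)).trans (by omega)
  · exact (size_mul_le a b).trans (by omega)
  · exact (size_mono (Nat.div_le_self a b)).trans (by omega)

theorem Expr.size_eval_le {ρ : ℕ → ℕ} {B : ℕ} (e : Expr) (h : ∀ i < e.width, (ρ i).size ≤ B) :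
    (e.eval ρ).size ≤ e.weight * (B + 1) := by
  induction e with
  | var i =>
    have := h i (Nat.lt_succ_self i)
    simp only [Expr.eval, Expr.weight]; omega
  | lit c => simp only [Expr.eval, Expr.weight]; nlinarith
  | op o a b iha ihb =>
    have h1 := iha fun i hi => h i (lt_max_of_lt_left hi)
    have h2 := ihb fun i hi => h i (lt_max_of_lt_right hi)
    have h3 := o.size_eval_le (a.eval ρ) (b.eval ρ)
    simp only [Expr.eval, Expr.weight]
    nlinarith
  | select c a b ihc iha ihb =>
    have h1 := iha fun i hi => h i (lt_max_of_lt_right (lt_max_of_lt_left hi))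
    have h2 := ihb fun i hi => h i (lt_max_of_lt_right (lt_max_of_lt_right hi))
    simp only [Expr.eval, Expr.weight]
    split_ifs <;> nlinarith

/-- The program `p` leads from the state `s` to the state `s'` at cost at most `T`. -/
def Runs (p : Prog) (s s' : State) (T : ℕ) : Prop := ∃ t ≤ T, Exec p s s' t

theorem Runs.mono {p : Prog} {s s' : State} {T T' : ℕ} (h : Runs p s s' T) (hT : T ≤ T') :
    Runs p s s' T' := by
  obtain ⟨t, ht, he⟩ := h
  exact ⟨t, ht.trans hT, he⟩

theorem Runs.seq {p q : Prog} {s s' s'' : State} {T T' : ℕ} (h : Runs p s s' T)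
    (h' : Runs q s' s'' T') : Runs (.seq p q) s s'' (T + T') := by
  obtain ⟨t, ht, he⟩ := h
  obtain ⟨t', ht', he'⟩ := h'
  exact ⟨t + t', by omega, .seq he he'⟩

/-- A loop that runs through the states `S 0, …, S n`. -/
theorem Runs.loop {p : Prog} {i T B : ℕ} (S : ℕ → State) (n : ℕ)
    (hne : ∀ k < n, (S k).reg i ≠ 0) (hB : ∀ k < n, ((S k).reg i).size ≤ B)
    (h0 : (S n).reg i = 0) (hstep : ∀ k < n, Runs p (S k) (S (k + 1)) T) :
    Runs (.loop i p) (S 0) (S n) (n * (1 + B + T) + 1) := by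
  induction n generalizing S with
  | zero => exact ⟨_, by simp [h0], .loopDone h0⟩
  | succ n ih =>
    obtain ⟨t', ht', he'⟩ := ih (fun k => S (k + 1)) (fun k hk => hne _ (by omega))
      (fun k hk => hB _ (by omega)) h0 (fun k hk => hstep _ (by omega))
    obtain ⟨t, ht, he⟩ := hstep 0 (by omega)
    refine ⟨_, ?_, .loopStep (hne 0 (by omega)) he he'⟩
    have := hB 0 (by omega)
    rw [Nat.succ_mul]
    omega

theorem State.setReg_setReg (s : State) (i v w : ℕ) :
    (s.setReg i v).setReg i w = s.setReg i w := by
  simp [State.setReg]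

theorem State.setReg_eq_self {s : State} {i v : ℕ} (h : s.reg i = v) : s.setReg i v = s := by
  subst h
  simp [State.setReg]

theorem State.setReg_comm (s : State) {i j : ℕ} (v w : ℕ) (h : i ≠ j) :
    (s.setReg i v).setReg j w = (s.setReg j w).setReg i v := by
  simp only [State.setReg, Function.update_comm h]

theorem State.setReg_reg_self (s : State) (i v : ℕ) : (s.setReg i v).reg i = v := by
  simp [State.setReg]

theorem State.setReg_reg_of_ne (s : State) {i j : ℕ} (v : ℕ) (h : j ≠ i) :
    (s.setReg i v).reg j = s.reg j := by
  simp [State.setReg, h]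

theorem Expr.runs_compile {B : ℕ} (e : Expr) {r : ℕ} {s : State} (hr : e.width ≤ r)
    (hs : ∀ j, r < j → s.reg j = 0) (hB : ∀ i < e.width, (s.reg i).size ≤ B) :
    Runs (e.compile r) s (s.setReg r (e.eval s.reg)) (e.weight * (B + 1)) := by
  induction e generalizing r s with
  | var i =>
    have h := Exec.arith .add r i (r + 1) s
    rw [hs (r + 1) (by omega)] at h
    refine ⟨_, ?_, h⟩
    have := hB i (Nat.lt_succ_self i)
    simp only [Expr.weight, Nat.size_zero]
    omega
  | lit c =>
    refine ⟨_, ?_, Exec.const r c s⟩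
    simp only [Expr.weight]
    nlinarith
  | op o a b iha ihb =>
    have hwa : a.width ≤ r := le_trans (le_max_left _ _) hr
    have hwb : b.width ≤ r := le_trans (le_max_right _ _) hr
    have hBa : ∀ i < a.width, (s.reg i).size ≤ B := fun i hi => hB i (lt_max_of_lt_left hi)
    have hBb : ∀ i < b.width, (s.reg i).size ≤ B := fun i hi => hB i (lt_max_of_lt_right hi)
    have h1 := iha hwa hs hBa
    set s₁ := s.setReg r (a.eval s.reg) with hs₁
    have hb : b.eval s₁.reg = b.eval s.reg := Expr.eval_congr b fun i hi => by
      rw [hs₁, State.setReg_reg_of_ne _ _ (by omega)]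
    have h2 := ihb (r := r + 1) (s := s₁) (by omega)
      (fun j hj => by rw [hs₁, State.setReg_reg_of_ne _ _ (by omega)]; exact hs j (by omega))
      (fun i hi => by rw [hs₁, State.setReg_reg_of_ne _ _ (by omega)]; exact hBb i hi)
    rw [hb] at h2
    set s₂ := s₁.setReg (r + 1) (b.eval s.reg) with hs₂
    have ha2 : s₂.reg r = a.eval s.reg := by
      rw [hs₂, State.setReg_reg_of_ne _ _ (by omega), hs₁, State.setReg_reg_self]
    have hb2 : s₂.reg (r + 1) = b.eval s.reg := by rw [hs₂, State.setReg_reg_self]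
    have h3 := Exec.arith o r r (r + 1) s₂
    rw [ha2, hb2] at h3
    have h4 := Exec.const (r + 1) 0 (s₂.setReg r (o.eval (a.eval s.reg) (b.eval s.reg)))
    have hfinal : (s₂.setReg r (o.eval (a.eval s.reg) (b.eval s.reg))).setReg (r + 1) 0 =
        s.setReg r (o.eval (a.eval s.reg) (b.eval s.reg)) := by
      rw [hs₂, State.setReg_comm _ _ _ (by omega), State.setReg_setReg, hs₁,
        State.setReg_comm _ _ _ (by omega), State.setReg_setReg,
        State.setReg_comm _ _ _ (by omega)]
      exact congrArg (fun x => State.setReg x r _) (State.setReg_eq_self (hs _ (by omega)))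
    rw [hfinal] at h4
    refine (h1.seq (h2.seq (Runs.seq ⟨_, le_rfl, h3⟩ ⟨_, le_rfl, h4⟩))).mono ?_
    have h5 := a.size_eval_le hBa
    have h6 := b.size_eval_le hBb
    simp only [Expr.weight, Nat.size_zero]
    nlinarith
  | select c a b ihc iha ihb =>
    have hwc : c.width ≤ r := le_trans (le_max_left _ _) hr
    have hwa : a.width ≤ r := le_trans (le_trans (le_max_left _ _) (le_max_right _ _)) hr
    have hwb : b.width ≤ r := le_trans (le_trans (le_max_right _ _) (le_max_right _ _)) hr
    have hBc : ∀ i < c.width, (s.reg i).size ≤ B := fun i hi => hB i (lt_max_of_lt_left hi)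
    have h1 := ihc hwc hs hBc
    have hsz := c.size_eval_le hBc
    set s₁ := s.setReg r (c.eval s.reg) with hs₁
    have hreg : ∀ i, i ≠ r → s₁.reg i = s.reg i := fun i hi =>
      State.setReg_reg_of_ne _ _ hi
    have hc : s₁.reg r = c.eval s.reg := State.setReg_reg_self _ _ _
    have ha : a.eval s₁.reg = a.eval s.reg :=
      Expr.eval_congr a fun i hi => hreg i (by omega)
    have hb : b.eval s₁.reg = b.eval s.reg :=
      Expr.eval_congr b fun i hi => hreg i (by omega)
    have h2 := iha (s := s₁) hwa (fun j hj => by rw [hreg j (by omega)]; exact hs j hj)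
      (fun i hi => by
        rw [hreg i (by omega)]; exact hB i (lt_max_of_lt_right (lt_max_of_lt_left hi)))
    have h3 := ihb (s := s₁) hwb (fun j hj => by rw [hreg j (by omega)]; exact hs j hj)
      (fun i hi => by
        rw [hreg i (by omega)]; exact hB i (lt_max_of_lt_right (lt_max_of_lt_right hi)))
    rw [ha, hs₁, State.setReg_setReg, ← hs₁] at h2
    rw [hb, hs₁, State.setReg_setReg, ← hs₁] at h3
    simp only [Expr.eval, Expr.compile]
    obtain ⟨t₂, ht₂, he₂⟩ := h2
    obtain ⟨t₃, ht₃, he₃⟩ := h3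
    by_cases h0 : c.eval s.reg = 0
    · rw [if_pos h0]
      refine (h1.seq ⟨_, le_rfl, .iteFalse (hc.trans h0) he₃⟩).mono ?_
      rw [hc]
      simp only [Expr.weight]
      nlinarith
    · rw [if_neg h0]
      refine (h1.seq ⟨_, le_rfl, .iteTrue (by rwa [hc]) he₂⟩).mono ?_
      rw [hc]
      simp only [Expr.weight]
      nlinarith

/-- The state whose first registers hold the entries of `l`, while all others are zero, and whose
memory is `μ`. -/
def cfg (l : List ℕ) (μ : ℕ → ℕ) : State := ⟨fun i => l.getD i 0, μ⟩

/-- Assignments to registers and to memory cells. -/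
inductive Instr
  | set (x : ℕ) (e : Expr)
  | store (a e : Expr)

namespace Instr

/-- The registers and the memory after the instruction. -/
def run : Instr → List ℕ × (ℕ → ℕ) → List ℕ × (ℕ → ℕ)
  | set x e, (l, μ) => (l.set x (e.eval fun i => l.getD i 0), μ)
  | store a e, (l, μ) =>
    (l, Function.update μ (a.eval fun i => l.getD i 0) (e.eval fun i => l.getD i 0))

/-- The instruction uses only the first `r` registers. -/
def Fits (r : ℕ) : Instr → Prop
  | set x e => x < r ∧ e.width ≤ r
  | store a e => a.width ≤ r ∧ e.width ≤ r

instance (r : ℕ) (i : Instr) : Decidable (i.Fits r) := by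
  cases i <;> unfold Fits <;> infer_instance

/-- The program of the instruction; it needs the auxiliary registers from `r` on. -/
def compile (r : ℕ) : Instr → Prog
  | set x e => .seq (e.compile r) (.seq (.arith .add x r (r + 1)) (.const r 0))
  | store a e => .seq (a.compile r) (.seq (e.compile (r + 1))
      (.seq (.store r (r + 1)) (.seq (.const (r + 1) 0) (.const r 0))))

/-- A factor for the cost of the instruction. -/
def weight : Instr → ℕ
  | set _ e => 2 * e.weight + 2
  | store a e => 2 * a.weight + 2 * e.weight + 3

end Instr

theorem cfg_setReg {l : List ℕ} {μ : ℕ → ℕ} {x v : ℕ} (h : x < l.length) :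
    (cfg l μ).setReg x v = cfg (l.set x v) μ := by
  unfold cfg State.setReg
  congr 1
  funext i
  by_cases hi : i = x
  · subst hi; simp [h]
  · simp [hi, List.getD_eq_getElem?_getD, List.getElem?_set_ne (Ne.symm hi)]

theorem cfg_reg_of_le {l : List ℕ} {μ : ℕ → ℕ} {j : ℕ} (h : l.length ≤ j) :
    (cfg l μ).reg j = 0 := by
  simp [cfg, h]

theorem cfg_reg_size_le {l : List ℕ} {μ : ℕ → ℕ} {B : ℕ} (h : ∀ x ∈ l, x.size ≤ B) (i : ℕ) :
    ((cfg l μ).reg i).size ≤ B := by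
  by_cases hi : i < l.length
  · simp only [cfg, List.getD_eq_getElem _ _ hi]
    exact h _ (List.getElem_mem hi)
  · rw [cfg_reg_of_le (by omega)]
    simp

theorem Instr.runs_compile (i : Instr) {l : List ℕ} {μ : ℕ → ℕ} {B : ℕ} (hi : i.Fits l.length)
    (hB : ∀ x ∈ l, x.size ≤ B) :
    Runs (i.compile l.length) (cfg l μ) (cfg (i.run (l, μ)).1 (i.run (l, μ)).2)
      (i.weight * (B + 1)) := by
  have hz : ∀ j, l.length ≤ j → (cfg l μ).reg j = 0 := fun j => cfg_reg_of_le
  cases i with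
  | set x e =>
    obtain ⟨hx, he⟩ := hi
    have h1 := e.runs_compile (s := cfg l μ) he (fun j hj => hz j hj.le)
      (fun i _ => cfg_reg_size_le hB i)
    have hsz := e.size_eval_le (ρ := (cfg l μ).reg) (fun i _ => cfg_reg_size_le hB i)
    set r := l.length
    set v := e.eval (cfg l μ).reg with hv
    have h2 := Exec.arith .add x r (r + 1) ((cfg l μ).setReg r v)
    rw [State.setReg_reg_self, State.setReg_reg_of_ne _ _ (by omega), hz (r + 1) (by omega)] at h2
    have h3 := Exec.const r 0 (((cfg l μ).setReg r v).setReg x v)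
    have hfin : (((cfg l μ).setReg r v).setReg x v).setReg r 0 = cfg (l.set x v) μ := by
      rw [State.setReg_comm _ _ _ (by omega), State.setReg_setReg,
        State.setReg_eq_self (hz r le_rfl), cfg_setReg hx]
    rw [hfin] at h3
    refine (h1.seq (Runs.seq ⟨_, le_rfl, h2⟩ ⟨_, le_rfl, h3⟩)).mono ?_
    simp only [Instr.weight, Nat.size_zero]
    nlinarith
  | store a e =>
    obtain ⟨ha, he⟩ := hi
    have h1 := a.runs_compile (s := cfg l μ) ha (fun j hj => hz j hj.le)
      (fun i _ => cfg_reg_size_le hB i)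
    have hsa := a.size_eval_le (ρ := (cfg l μ).reg) (fun i _ => cfg_reg_size_le hB i)
    have hse := e.size_eval_le (ρ := (cfg l μ).reg) (fun i _ => cfg_reg_size_le hB i)
    set r := l.length
    set u := a.eval (cfg l μ).reg with hu
    set v := e.eval (cfg l μ).reg with hv
    have hreg : ∀ i, i ≠ r → ((cfg l μ).setReg r u).reg i = (cfg l μ).reg i := fun i hi =>
      State.setReg_reg_of_ne _ _ hi
    have h2 := e.runs_compile (s := (cfg l μ).setReg r u) (r := r + 1) (by omega)
      (fun j hj => by rw [hreg j (by omega)]; exact hz j (by omega))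
      (fun i hi => by rw [hreg i (by omega)]; exact cfg_reg_size_le hB i)
    rw [e.eval_congr fun i hi => hreg i (by omega), ← hv] at h2
    have h3 := Exec.store r (r + 1) (((cfg l μ).setReg r u).setReg (r + 1) v)
    rw [State.setReg_reg_self, State.setReg_reg_of_ne _ _ (by omega), State.setReg_reg_self] at h3
    have h4 := Exec.const (r + 1) 0 ((((cfg l μ).setReg r u).setReg (r + 1) v).setMem u v)
    have h5 := Exec.const r 0
      (((((cfg l μ).setReg r u).setReg (r + 1) v).setMem u v).setReg (r + 1) 0)
    have hfin : (((((cfg l μ).setReg r u).setReg (r + 1) v).setMem u v).setReg (r + 1) 0).setReg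
        r 0 = cfg l (Function.update μ u v) := by
      have h6 : ((((cfg l μ).setReg r u).setReg (r + 1) v).setReg (r + 1) 0).setReg r 0 =
          cfg l μ := by
        rw [State.setReg_setReg, State.setReg_comm _ _ _ (by omega), State.setReg_setReg,
          State.setReg_eq_self (hz r le_rfl), State.setReg_eq_self (hz (r + 1) (by omega))]
      exact congrArg (fun s : State => State.mk s.reg (Function.update μ u v)) h6
    rw [hfin] at h5
    refine (h1.seq (h2.seq (Runs.seq ⟨_, le_rfl, h3⟩ (Runs.seq ⟨_, le_rfl, h4⟩
      ⟨_, le_rfl, h5⟩)))).mono ?_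
    simp only [Instr.weight, Nat.size_zero]
    nlinarith

/-- A list of instructions. -/
abbrev Block := List Instr

namespace Block

/-- The registers and the memory after the block. -/
def run (b : Block) (c : List ℕ × (ℕ → ℕ)) : List ℕ × (ℕ → ℕ) := b.foldl (fun c i => i.run c) c

/-- The program of the block; the empty block clears a register that is zero anyway. -/
def compile (r : ℕ) : Block → Prog
  | [] => .const r 0
  | i :: b => .seq (i.compile r) (compile r b)

/-- A factor for the cost of the block. An instruction may multiply the bound for the sizes of the
registers by its own weight, hence the product. -/
def weight : Block → ℕ
  | [] => 1
  | i :: b => i.weight + (i.weight + 2) * weight b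

/-- Straight-line programs take time linear in the sizes of the registers. -/
theorem runs_compile (b : Block) {l : List ℕ} {μ : ℕ → ℕ} {B : ℕ}
    (hi : ∀ i ∈ b, Instr.Fits l.length i) (hB : ∀ x ∈ l, x.size ≤ B) :
    Runs (b.compile l.length) (cfg l μ) (cfg (b.run (l, μ)).1 (b.run (l, μ)).2)
      (b.weight * (B + 1)) := by
  induction b generalizing l μ B with
  | nil =>
    have h := Exec.const l.length 0 (cfg l μ)
    rw [State.setReg_eq_self (cfg_reg_of_le le_rfl)] at h
    exact ⟨_, by simp [weight], h⟩
  | cons i b ih =>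
    have h1 := i.runs_compile (μ := μ) (hi i (by simp)) hB
    have hlen : (i.run (l, μ)).1.length = l.length := by
      cases i <;> simp [Instr.run]
    have hsz : ∀ x ∈ (i.run (l, μ)).1, x.size ≤ (i.weight + 1) * (B + 1) := by
      intro x hx
      cases i with
      | set y e =>
        rcases List.mem_or_eq_of_mem_set hx with hx | rfl
        · have := hB x hx
          nlinarith
        · have := e.size_eval_le (ρ := (cfg l μ).reg) (fun i _ => cfg_reg_size_le hB i)
          simp only [Instr.weight]
          exact this.trans (Nat.mul_le_mul_right _ (by omega))
      | store a e =>
        have := hB x hx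
        nlinarith
    have h2 := ih (μ := (i.run (l, μ)).2) (fun j hj => by
      rw [hlen]; exact hi j (List.mem_cons_of_mem _ hj)) hsz
    rw [hlen] at h2
    refine (h1.seq h2).mono ?_
    simp only [weight]
    nlinarith [Nat.zero_le (weight b * B), Nat.zero_le (weight b)]

end Block

end RAM

/-! ### Evaluating incidences on a machine -/

-- All programs below use the following registers. Those from `8` to `18` are temporary and are zero
-- between two steps of the main loop; those from `19` on belong to compiled expressions.
--   `0`: length of the output       `1`: base of the packed formula  `2`: packed formula
--   `3`: number of its digits       `4`: number of coordinates       `5`: length of the paths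
--   `6`: number of the edge         `7`: remaining edges             `8`: vector
--   `9`: coordinate                 `10`: position on the path       `11`: unread part of `2`
--   `12`, `13`, `14`: state of the scan                              `15`: remaining digits
--   `16`: digit                     `17`: halved assignment          `18`: remaining halvings
-- Some of them serve other purposes as well, before the main loop or after the scan.

namespace HyperbolicityReduction

open RAM RAM.Expr

/-- The literal `y = 2 * x + s` is satisfied by the vector `v`: the variable `x` is on the side of
`v`, that is, it has the parity of `v - 3`, and the bit `x / 2` of `(v - 3) / 2` is `s`. -/
def LitTrue (v y : ℕ) : Prop :=
  y / 2 % 2 = (v - 3) % 2 ∧ (v - 3) / 2 / 2 ^ (y / 4) % 2 = y % 2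

instance (v y : ℕ) : Decidable (LitTrue v y) := by unfold LitTrue; infer_instance

/-- The vector `v` satisfies the clause number `p`. -/
def ClauseTrue (cl : List (List ℕ)) (v p : ℕ) : Prop :=
  ∃ C, cl[p]? = some C ∧ ∃ y ∈ C, LitTrue v y

/-- The incidence relation between vectors and coordinates that belongs to a list of clauses.
The vector `0` contains all coordinates, and the vectors `1` and `2` are `{0, 1}` and `{2, 3}`.
Each further vector stands for an assignment to the variables on its side; it contains `0` and `2`,
or `1` and `3`, according to its side, and `p + 4` if it does not satisfy the clause `p`. -/
def Incident (cl : List (List ℕ)) (v κ : ℕ) : Prop :=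
  if v = 0 then True
  else if v = 1 then κ / 2 = 0
  else if v = 2 then κ / 2 = 1
  else if κ < 4 then κ % 2 = (v - 3) % 2
  else ¬ ClauseTrue cl v (κ - 4)

/-- One step of the search for a satisfied literal in the clause `κ - 4`. The state consists of the
number of literals to come in the present clause, the number of clauses that were begun, and the
result so far. The next entry is a literal, or the length of a clause. -/
def scanStep (v κ : ℕ) (s : ℕ × ℕ × ℕ) (y : ℕ) : ℕ × ℕ × ℕ :=
  if s.1 = 0 then (y, s.2.1 + 1, s.2.2)
  else (s.1 - 1, s.2.1, if s.2.1 = κ - 3 ∧ LitTrue v y then 1 else s.2.2)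

/-- After a clause the result is `1` if it is the clause in question and has a satisfied literal. -/
theorem foldl_scanStep_clause (v κ q f : ℕ) (C : List ℕ) :
    C.foldl (scanStep v κ) (C.length, q, f) =
      (0, q, if q = κ - 3 ∧ ∃ y ∈ C, LitTrue v y then 1 else f) := by
  induction C generalizing f with
  | nil => simp
  | cons y C ih =>
    rw [List.foldl_cons]
    have : scanStep v κ ((y :: C).length, q, f) y =
        (C.length, q, if q = κ - 3 ∧ LitTrue v y then 1 else f) := by
      simp [scanStep]
    rw [this, ih]
    by_cases h1 : q = κ - 3 <;> by_cases h2 : LitTrue v y <;> simp [h1, h2]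

open Classical in
theorem foldl_scanStep (v κ q f : ℕ) (cl : List (List ℕ)) (hq : q < κ - 3) :
    (((cl.flatMap fun C => C.length :: C).foldl (scanStep v κ) (0, q, f)).2.2 =
      if ClauseTrue cl v (κ - 4 - q) then 1 else f) := by
  induction cl generalizing q f with
  | nil => simp [ClauseTrue]
  | cons C cl ih =>
    rw [List.flatMap_cons, List.foldl_append, List.foldl_cons]
    have : scanStep v κ (0, q, f) C.length = (C.length, q + 1, f) := by simp [scanStep]
    rw [this, foldl_scanStep_clause]
    by_cases h1 : q + 1 = κ - 3
    -- The clauses after the one in question do not change the result.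
    · have h2 : ∀ (l : List (List ℕ)) (s : ℕ × ℕ × ℕ), κ - 3 ≤ s.2.1 → (s.1 = 0) →
          (((l.flatMap fun C => C.length :: C).foldl (scanStep v κ) s).2.2 = s.2.2) := by
        intro l
        induction l with
        | nil => intros; rfl
        | cons C l ih =>
          rintro ⟨r, q, f⟩ h3 h4
          simp only at h3 h4
          subst h4
          rw [List.flatMap_cons, List.foldl_append, List.foldl_cons]
          have : scanStep v κ (0, q, f) C.length = (C.length, q + 1, f) := by simp [scanStep]
          rw [this, foldl_scanStep_clause, ih _ (by simp only; omega) rfl]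
          rw [if_neg (by omega)]
      rw [h2 _ _ (by simp only; omega) rfl]
      have h3 : κ - 4 - q = 0 := by omega
      simp [h1, ClauseTrue, h3]
    · have h3 : ClauseTrue (C :: cl) v (κ - 4 - q) = ClauseTrue cl v (κ - 4 - (q + 1)) := by
        rw [show κ - 4 - q = κ - 4 - (q + 1) + 1 by omega]
        simp [ClauseTrue]
      rw [ih _ _ (by omega), if_neg (show ¬ (q + 1 = κ - 3 ∧ ∃ y ∈ C, LitTrue v y) by tauto)]
      simp only [h3]

theorem scanStep_bounds {v κ B k : ℕ} {s : ℕ × ℕ × ℕ} {y : ℕ} (hy : y < B)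
    (h : s.1 < B ∧ s.2.1 ≤ k ∧ s.2.2 ≤ 1) :
    (scanStep v κ s y).1 < B ∧ (scanStep v κ s y).2.1 ≤ k + 1 ∧ (scanStep v κ s y).2.2 ≤ 1 := by
  unfold scanStep
  split_ifs <;> refine ⟨?_, ?_, ?_⟩ <;> simp only <;> omega

theorem foldl_scanStep_bounds {v κ B : ℕ} (D : List ℕ) (hB : 0 < B) (hD : ∀ y ∈ D, y < B) :
    (D.foldl (scanStep v κ) (0, 0, 0)).1 < B ∧
      (D.foldl (scanStep v κ) (0, 0, 0)).2.1 ≤ D.length ∧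
      (D.foldl (scanStep v κ) (0, 0, 0)).2.2 ≤ 1 := by
  induction D using List.reverseRecOn with
  | nil => simpa using hB
  | append_singleton D y ih =>
    rw [List.foldl_append, List.length_append]
    exact scanStep_bounds (hD y (by simp)) (ih fun z hz => hD z (by simp [hz]))

theorem runs_block (b : Block) {l l' : List ℕ} {μ μ' : ℕ → ℕ} {r S M : ℕ} (hr : l.length = r)
    (hi : ∀ i ∈ b, Instr.Fits r i) (hM : ∀ x ∈ l, x ≤ M) (hS : M.size ≤ S)
    (h : b.run (l, μ) = (l', μ')) :
    Runs (b.compile r) (cfg l μ) (cfg l' μ') (b.weight * (S + 1)) := by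
  subst hr
  have := b.runs_compile (μ := μ) hi fun x hx => (size_mono (hM x hx)).trans hS
  rwa [h] at this

def halveBody : Block := [.set 17 (var 17 / 2), .set 18 (var 18 - 1)]

/-- Halving register `17` as often as register `18` says. -/
def halve : Prog := .loop 18 (halveBody.compile 19)

theorem runs_halve : ∃ c, ∀ (a : List ℕ) (μ : ℕ → ℕ) (g n S M : ℕ), a.length = 17 →
    (∀ x ∈ a, x ≤ M) → g ≤ M → n ≤ M → n ≤ S → M.size ≤ S →
    Runs halve (cfg (a ++ [g, n]) μ) (cfg (a ++ [g / 2 ^ n, 0]) μ) (c * (S + 1) ^ 2) := by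
  refine ⟨halveBody.weight + 1, fun a μ g n S M ha hM hg hn hnS hS => ?_⟩
  have hreg : ∀ k, (cfg (a ++ [g / 2 ^ k, n - k]) μ).reg 18 = n - k := by
    intro k
    simp [cfg, List.getD_eq_getElem?_getD, ha]
  have h := Runs.loop (p := halveBody.compile 19) (i := 18) (B := S)
    (T := halveBody.weight * (S + 1)) (fun k => cfg (a ++ [g / 2 ^ k, n - k]) μ) n
    (fun k hk => by rw [hreg]; omega)
    (fun k hk => by rw [hreg]; exact (size_mono (by omega)).trans hS)
    (by rw [hreg]; omega)
    (fun k hk => by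
      refine runs_block halveBody (by simp [ha]) (by decide) (M := M) ?_ hS ?_
      · simp only [List.mem_append, List.mem_cons, List.not_mem_nil, or_false]
        rintro x (hx | rfl | rfl)
        · exact hM x hx
        · exact (Nat.div_le_self _ _).trans hg
        · omega
      · simp [halveBody, Block.run, Instr.run, List.getD_eq_getElem?_getD, ha,
          Nat.div_div_eq_div_mul, pow_succ, Nat.sub_sub])
  simp only [pow_zero, Nat.div_one, Nat.sub_zero, Nat.sub_self] at h
  refine h.mono ?_
  have : n * (1 + S + halveBody.weight * (S + 1)) ≤ S * (1 + S + halveBody.weight * (S + 1)) :=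
    Nat.mul_le_mul_right _ hnS
  nlinarith [Nat.zero_le halveBody.weight, Nat.zero_le (halveBody.weight * S)]

/-- Taking the next entry from the packed formula in register `11`. -/
def scanFetch : Block :=
  [.set 16 (var 11 % var 1), .set 11 (var 11 / var 1), .set 17 ((var 8 - 3) / 2),
    .set 18 (var 16 / 4), .set 15 (var 15 - 1)]

/-- The effect of `scanStep` on the registers `12`, `13` and `14`. -/
def scanUpdate : Block :=
  [.set 14 (select (var 12) (select (eq (var 13) (var 9 - 3))
      (select (eq (var 16 / 2 % 2) ((var 8 - 3) % 2))
        (select (eq (var 17 % 2) (var 16 % 2)) 1 (var 14)) (var 14)) (var 14)) (var 14)),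
    .set 13 (select (var 12) (var 13) (var 13 + 1)),
    .set 12 (select (var 12) (var 12 - 1) (var 16)),
    .set 16 0, .set 17 0]

/-- Scanning the packed formula in register `11`. -/
def scan : Prog :=
  .loop 15 (.seq (scanFetch.compile 19) (.seq halve (scanUpdate.compile 19)))

theorem scanUpdate_run (a0 a1 a2 a3 a4 a5 a6 a7 v κ t W' c2 y : ℕ) (s : ℕ × ℕ × ℕ)
    (μ : ℕ → ℕ) :
    scanUpdate.run ([a0, a1, a2, a3, a4, a5, a6, a7, v, κ, t, W', s.1, s.2.1, s.2.2, c2, y,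
        (v - 3) / 2 / 2 ^ (y / 4), 0], μ) =
      ([a0, a1, a2, a3, a4, a5, a6, a7, v, κ, t, W', (scanStep v κ s y).1,
        (scanStep v κ s y).2.1, (scanStep v κ s y).2.2, c2, 0, 0, 0], μ) := by
  obtain ⟨r, q, f⟩ := s
  by_cases h0 : r = 0
  · simp [scanUpdate, Block.run, Instr.run, scanStep, h0]
  · simp only [scanUpdate, Block.run, Instr.run, scanStep, LitTrue]
    by_cases h1 : q = κ - 3 <;> by_cases h2 : y / 2 % 2 = (v - 3) % 2 <;>
      by_cases h3 : (v - 3) / 2 / 2 ^ (y / 4) % 2 = y % 2 <;> simp [h0, h1, h2, h3]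

theorem runs_scan : ∃ c, ∀ (ptr B K L w cnt v κ t S M : ℕ) (D : List ℕ) (μ : ℕ → ℕ),
    ptr ≤ M → B ≤ M → Nat.ofDigits B D ≤ M → D.length ≤ M → K ≤ M → L ≤ M → w ≤ M → cnt ≤ M →
    v ≤ M → κ ≤ M → t ≤ M → 1 ≤ B → B ≤ S → D.length ≤ S → M.size ≤ S → (∀ y ∈ D, y < B) →
    Runs scan
      (cfg [ptr, B, Nat.ofDigits B D, D.length, K, L, w, cnt, v, κ, t, Nat.ofDigits B D,
        0, 0, 0, D.length, 0, 0, 0] μ)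
      (cfg [ptr, B, Nat.ofDigits B D, D.length, K, L, w, cnt, v, κ, t, 0,
        (D.foldl (scanStep v κ) (0, 0, 0)).1, (D.foldl (scanStep v κ) (0, 0, 0)).2.1,
        (D.foldl (scanStep v κ) (0, 0, 0)).2.2, 0, 0, 0, 0] μ) (c * (S + 1) ^ 3) := by
  obtain ⟨c, hc⟩ := runs_halve
  refine ⟨scanFetch.weight + c + scanUpdate.weight + 1, ?_⟩
  intro ptr B K L w cnt v κ t S M D μ h0 h1 h2 h3 h4 h5 h6 h7 h8 h9 h10 hB hBS hDS hS hD
  let f : ℕ → ℕ × ℕ × ℕ := fun k => (D.take k).foldl (scanStep v κ) (0, 0, 0)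
  have hf : ∀ k, (f k).1 < B ∧ (f k).2.1 ≤ M ∧ (f k).2.2 ≤ 1 := by
    intro k
    have := foldl_scanStep_bounds (v := v) (κ := κ) (D.take k) hB
      fun y hy => hD y (List.mem_of_mem_take hy)
    refine ⟨this.1, this.2.1.trans (le_trans ?_ h3), this.2.2⟩
    simp
  have hW : ∀ k, Nat.ofDigits B D / B ^ k = Nat.ofDigits B (D.drop k) := fun k =>
    Nat.ofDigits_div_pow_eq_ofDigits_drop k (by omega) D hD
  have hWM : ∀ k, Nat.ofDigits B (D.drop k) ≤ M := fun k => by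
    rw [← hW]; exact (Nat.div_le_self _ _).trans h2
  have h := Runs.loop
    (p := .seq (scanFetch.compile 19) (.seq halve (scanUpdate.compile 19))) (i := 15) (B := S)
    (T := (scanFetch.weight + c + scanUpdate.weight) * (S + 1) ^ 2)
    (fun k => cfg [ptr, B, Nat.ofDigits B D, D.length, K, L, w, cnt, v, κ, t,
      Nat.ofDigits B (D.drop k), (f k).1, (f k).2.1, (f k).2.2, D.length - k, 0, 0, 0] μ)
    D.length
    (fun k hk => by simp [cfg]; omega)
    (fun k hk => by simp [cfg]; exact (size_mono (by omega)).trans hS)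
    (by simp [cfg])
    (fun k hk => by
      have hdrop : D.drop k = D[k] :: D.drop (k + 1) := List.drop_eq_getElem_cons hk
      have hy : D[k] < B := hD _ (List.getElem_mem hk)
      have hW1 : Nat.ofDigits B (D.drop k) % B = D[k] := by
        rw [hdrop, Nat.ofDigits_cons, Nat.add_mul_mod_self_left, Nat.mod_eq_of_lt]
        exact hy
      have hW2 : Nat.ofDigits B (D.drop k) / B = Nat.ofDigits B (D.drop (k + 1)) := by
        rw [← hW, ← hW, Nat.div_div_eq_div_mul, pow_succ]
      have hfk : f (k + 1) = scanStep v κ (f k) D[k] := by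
        simp only [f]
        rw [List.take_succ_eq_append_getElem hk, List.foldl_append]
        rfl
      obtain ⟨hf1, hf2, hf3⟩ := hf k
      have e1 := runs_block scanFetch (r := 19) (S := S) (M := M) (μ := μ) (μ' := μ)
        (l := [ptr, B, Nat.ofDigits B D, D.length, K, L, w, cnt, v, κ, t,
          Nat.ofDigits B (D.drop k), (f k).1, (f k).2.1, (f k).2.2, D.length - k, 0, 0, 0])
        (l' := [ptr, B, Nat.ofDigits B D, D.length, K, L, w, cnt, v, κ, t,
          Nat.ofDigits B (D.drop (k + 1)), (f k).1, (f k).2.1, (f k).2.2, D.length - (k + 1),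
          D[k]] ++ [(v - 3) / 2, D[k] / 4]) rfl (by decide)
        (by
          have := hWM k
          simp only [List.mem_cons, List.not_mem_nil, or_false, forall_eq_or_imp, forall_eq]
          omega) hS
        (by simp [scanFetch, Block.run, Instr.run, hW1, hW2, Nat.sub_sub])
      have e2 := hc [ptr, B, Nat.ofDigits B D, D.length, K, L, w, cnt, v, κ, t,
          Nat.ofDigits B (D.drop (k + 1)), (f k).1, (f k).2.1, (f k).2.2, D.length - (k + 1),
          D[k]] μ ((v - 3) / 2) (D[k] / 4) S M rfl
        (by
          have := hWM (k + 1)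
          simp only [List.mem_cons, List.not_mem_nil, or_false, forall_eq_or_imp, forall_eq]
          omega) (by omega) (by omega) (by omega) hS
      have e3 := runs_block scanUpdate (r := 19) (S := S) (M := M) (hr := rfl) (hi := by decide)
        (hS := hS) (h := scanUpdate_run ptr B (Nat.ofDigits B D) D.length K L w cnt v κ t
          (Nat.ofDigits B (D.drop (k + 1))) (D.length - (k + 1)) D[k] (f k) μ)
        (hM := by
          have := hWM (k + 1)
          have : (v - 3) / 2 / 2 ^ (D[k] / 4) ≤ M := by
            refine (Nat.div_le_self _ _).trans ?_
            omega
          simp only [List.mem_cons, List.not_mem_nil, or_false, forall_eq_or_imp, forall_eq]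
          omega)
      rw [← hfk] at e3
      refine (e1.seq (e2.seq e3)).mono ?_
      have : S + 1 ≤ (S + 1) ^ 2 := by nlinarith
      nlinarith [Nat.mul_le_mul_left scanFetch.weight this,
        Nat.mul_le_mul_left scanUpdate.weight this])
  simp only [f, List.drop_zero, List.take_zero, List.foldl_nil, Nat.sub_zero, List.drop_length,
    List.take_length, Nat.sub_self, Nat.ofDigits_nil] at h
  refine h.mono ?_
  set wt := scanFetch.weight + c + scanUpdate.weight
  have h1 : D.length * (1 + S + wt * (S + 1) ^ 2) ≤ S * (1 + S + wt * (S + 1) ^ 2) :=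
    Nat.mul_le_mul_right _ hDS
  have h2 : (wt + 1) * (S + 1) ^ 3 =
      S * (1 + S + wt * (S + 1) ^ 2) + 1 + (wt * (S + 1) ^ 2 + S ^ 3 + 2 * S ^ 2 + 2 * S) := by
    ring
  omega

end HyperbolicityReduction

/-! ### Writing the edge list -/

namespace HyperbolicityReduction

open RAM RAM.Expr IncidenceGraph

/-- The memory that holds the entries of `l`, followed by zeros. -/
def cells (l : List ℕ) : ℕ → ℕ := fun a => l.getD a 0

theorem update_cells_length (l : List ℕ) (x : ℕ) :
    Function.update (cells l) l.length x = cells (l ++ [x]) := by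
  funext a
  unfold cells
  by_cases h : a = l.length
  · subst h; simp
  · rw [Function.update_of_ne h]
    rcases lt_or_gt_of_ne h with h | h
    · simp [List.getD_eq_getElem?_getD, List.getElem?_append_left h]
    · rw [List.getD_eq_default _ _ h.le, List.getD_eq_default _ _ (by simp; omega)]

theorem update_cells_zero (l : List ℕ) {a : ℕ} (ha : l.length ≤ a) :
    Function.update (cells l) a 0 = cells l := by
  rw [Function.update_eq_self_iff]
  simp [cells, ha]

/-- The numbers of the end points of the edges, one edge after the other. -/
def flatten (es : List (ℕ × ℕ)) : List ℕ := es.flatMap fun e => [e.1, e.2]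

/-- Decoding the number of an edge. -/
def decode : Block :=
  [.set 8 (var 6 / 2 / (var 5 + 1) / var 4), .set 9 (var 6 / 2 / (var 5 + 1) % var 4),
    .set 10 (var 6 / 2 % (var 5 + 1)), .set 11 (var 2), .set 15 (var 3)]

/-- The incidence of the vector in register `8` and the coordinate in register `9`, where register
`14` tells whether the vector satisfies the clause of this coordinate. -/
def incidentExpr : Expr :=
  select (var 8)
    (select (eq (var 8) 1) (eq (var 9 / 2) 0)
      (select (eq (var 8) 2) (eq (var 9 / 2) 1)
        (select (4 - var 9) (eq (var 9 % 2) ((var 8 - 3) % 2)) (1 - var 14)))) 1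

/-- Whether there is an edge with the number in register `6`. -/
def edgeExistsExpr : Expr :=
  select (var 6 % 2) (select (eq (var 10) (var 5)) (select (eq (var 9 + 1) (var 4)) 0 1) 1)
    (select (var 10) 0 (select (var 8) 1 0))

/-- The end point of the edge with the number in register `6`. -/
def edgeEndExpr : Expr :=
  select (var 6 % 2)
    (select (eq (var 10) (var 5)) (var 6 / 2 + (var 5 + 1))
      (select (eq (var 10 + 1) (var 5)) (select (var 14) (var 6 / 2 + 1) (var 6 / 2 + 1 - var 5))
        (var 6 / 2 + 1)))
    ((var 8 / 2 * var 4 + var 9) * (var 5 + 1))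

/-- Computing the incidence into register `14`, and then into registers `16` and `17` whether there
is an edge, and its end point. -/
def computeEdge : Block :=
  [.set 14 incidentExpr, .set 16 edgeExistsExpr, .set 17 (var 16 * edgeEndExpr)]

/-- If there is an edge, then it is appended to the output. Otherwise zeros are written behind the
output, which does not change the memory. -/
def writeEdge : Block :=
  [.store (var 0) (var 16 * (var 6 / 2)), .store (var 0 + 1) (var 17),
    .set 0 (var 0 + 2 * var 16), .set 6 (var 6 + 1), .set 7 (var 7 - 1), .set 8 0, .set 9 0,
    .set 10 0, .set 12 0, .set 13 0, .set 14 0, .set 16 0, .set 17 0]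

/-- Writing the edges, one after the other, behind the first two cells. -/
def emit : Prog :=
  .loop 7 (.seq (decode.compile 19) (.seq scan
    (.seq (computeEdge.compile 19) (writeEdge.compile 19))))

open Classical in
theorem eval_incidentExpr {ρ : ℕ → ℕ} (cl : List (List ℕ))
    (h : 4 ≤ ρ 9 → ρ 14 = if ClauseTrue cl (ρ 8) (ρ 9 - 4) then 1 else 0) :
    incidentExpr.eval ρ = if Incident cl (ρ 8) (ρ 9) then 1 else 0 := by
  unfold incidentExpr Incident
  by_cases h0 : ρ 8 = 0
  · simp [h0]
  by_cases h1 : ρ 8 = 1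
  · simp [h1]
  by_cases h2 : ρ 8 = 2
  · simp [h2]
  by_cases h3 : ρ 9 < 4
  · have : 4 - ρ 9 ≠ 0 := by omega
    simp [h0, h1, h2, h3, this]
  · have : 4 - ρ 9 = 0 := by omega
    simp only [eval_select, eval_var, eval_eq, eval_ofNat, eval_sub, h0, h1, h2, h3, this,
      h (by omega), if_false, if_true]
    split_ifs <;> simp_all

open Classical in
theorem eval_edgeExprs {ρ : ℕ → ℕ} {w : ℕ} (I : ℕ → ℕ → Prop)
    (h6 : ρ 6 = w) (h8 : ρ 8 = w / 2 / (ρ 5 + 1) / ρ 4)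
    (h9 : ρ 9 = w / 2 / (ρ 5 + 1) % ρ 4) (h10 : ρ 10 = w / 2 % (ρ 5 + 1))
    (h14 : ρ 14 = if I (ρ 8) (ρ 9) then 1 else 0) :
    (edgeAt (ρ 4) (ρ 5) I w = none ∧ edgeExistsExpr.eval ρ = 0) ∨
      (edgeAt (ρ 4) (ρ 5) I w = some (w / 2, edgeEndExpr.eval ρ) ∧ edgeExistsExpr.eval ρ = 1) := by
  unfold edgeAt IncidenceGraph.next edgeExistsExpr edgeEndExpr vertex
  simp only [← h8, ← h9, ← h10]
  simp only [eval_select, eval_var, eval_eq, eval_ofNat, eval_sub, eval_add, eval_mod, eval_div,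
    eval_mul, h6, h14]
  by_cases c1 : w % 2 = 0
  · by_cases c2 : ρ 10 = 0 <;> by_cases c3 : ρ 8 = 0 <;> simp [c1, c2, c3]
  · by_cases c2 : ρ 10 = ρ 5 <;> by_cases c3 : ρ 9 + 1 = ρ 4 <;> by_cases c4 : ρ 10 + 1 = ρ 5 <;>
      by_cases c5 : I (ρ 8) (ρ 9) <;> simp [c1, c2, c3, c4, c5]

theorem flatten_length (es : List (ℕ × ℕ)) : (flatten es).length = 2 * es.length := by
  unfold flatten
  induction es with
  | nil => rfl
  | cons e es ih => rw [List.flatMap_cons, List.length_append, ih]; simp; ring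

theorem flatten_append (es es' : List (ℕ × ℕ)) :
    flatten (es ++ es') = flatten es ++ flatten es' := by
  simp [flatten]

/-- The effect of `writeEdge` in dependence on the optional edge `e`. -/
theorem writeEdge_run (B W D K L w cnt v κ t r q f x y : ℕ) (l : List ℕ) (e : Option (ℕ × ℕ))
    (h : (e = none ∧ x = 0 ∧ y = 0) ∨ (e = some (w / 2, y) ∧ x = 1)) :
    writeEdge.run ([l.length, B, W, D, K, L, w, cnt, v, κ, t, 0, r, q, f, 0, x, y, 0], cells l) =
      ([(l ++ flatten e.toList).length, B, W, D, K, L, w + 1, cnt - 1,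
        0, 0, 0, 0, 0, 0, 0, 0, 0, 0, 0], cells (l ++ flatten e.toList)) := by
  have hrun : writeEdge.run
      ([l.length, B, W, D, K, L, w, cnt, v, κ, t, 0, r, q, f, 0, x, y, 0], cells l) =
      ([l.length + 2 * x, B, W, D, K, L, w + 1, cnt - 1, 0, 0, 0, 0, 0, 0, 0, 0, 0, 0, 0],
        Function.update (Function.update (cells l) l.length (x * (w / 2))) (l.length + 1) y) := by
    simp [writeEdge, Block.run, Instr.run]
  rw [hrun]
  rcases h with ⟨rfl, rfl, rfl⟩ | ⟨rfl, rfl⟩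
  · rw [zero_mul, update_cells_zero l le_rfl, update_cells_zero l (by omega)]
    simp [flatten]
  · have h1 := update_cells_length (l ++ [w / 2]) y
    rw [List.length_append, List.length_singleton] at h1
    rw [one_mul, update_cells_length, h1]
    simp [flatten]

open Classical in
theorem runs_emit : ∃ c, ∀ (K X L B S M δ : ℕ) (cl : List (List ℕ)) (D : List ℕ),
    D = cl.flatMap (fun C => C.length :: C) →
    0 < K → 4 * order K X L + 2 ≤ M → B ≤ M → Nat.ofDigits B D ≤ M → D.length ≤ M → K ≤ M →
    L ≤ M → 1 ≤ B → B ≤ S → D.length ≤ S → M.size ≤ S → (∀ y ∈ D, y < B) →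
    Runs emit
      (cfg [2, B, Nat.ofDigits B D, D.length, K, L, 0, 2 * order K X L,
        0, 0, 0, 0, 0, 0, 0, 0, 0, 0, 0] (cells [order K X L, δ]))
      (cfg [(order K X L :: δ :: flatten (edges K X L (Incident cl))).length, B,
        Nat.ofDigits B D, D.length, K, L,
        2 * order K X L, 0, 0, 0, 0, 0, 0, 0, 0, 0, 0, 0, 0]
        (cells (order K X L :: δ :: flatten (edges K X L (Incident cl)))))
      (c * (order K X L + 1) * (S + 1) ^ 3) := by
  obtain ⟨c, hc⟩ := runs_scan
  set wt := decode.weight + c + computeEdge.weight + writeEdge.weight with hwt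
  refine ⟨2 * wt + 3, ?_⟩
  intro K X L B S M δ cl D hDcl hK hN hBM hWM hDM hKM hLM hB hBS hDS hS hD
  set N := order K X L with hNdef
  let out : ℕ → List ℕ := fun k =>
    N :: δ :: flatten ((List.range k).filterMap (edgeAt K L (Incident cl)))
  have hout : ∀ k, out (k + 1) = out k ++ flatten (edgeAt K L (Incident cl) k).toList := by
    intro k
    simp only [out, List.range_succ, List.filterMap_append, flatten_append, List.cons_append]
    congr 4
  have hlen : ∀ k, (out k).length ≤ 2 * k + 2 := by
    intro k
    simp only [out, List.length_cons, flatten_length]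
    have := List.length_filterMap_le (edgeAt K L (Incident cl)) (List.range k)
    rw [List.length_range] at this
    omega
  have h := Runs.loop
    (p := .seq (decode.compile 19) (.seq scan
      (.seq (computeEdge.compile 19) (writeEdge.compile 19)))) (i := 7) (B := S)
    (T := wt * (S + 1) ^ 3)
    (fun k => cfg [(out k).length, B, Nat.ofDigits B D, D.length, K, L, k, 2 * N - k,
        0, 0, 0, 0, 0, 0, 0, 0, 0, 0, 0] (cells (out k))) (2 * N)
    (fun k hk => by simp [cfg]; omega)
    (fun k hk => by
      have : 2 * N - k ≤ M := by omega
      simpa [cfg] using (size_mono this).trans hS)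
    (by simp [cfg])
    (fun k hk => by
      have hlk := hlen k
      set v := k / 2 / (L + 1) / K with hv
      set κ := k / 2 / (L + 1) % K with hκ
      set t := k / 2 % (L + 1) with ht
      have hvM : v ≤ M := by
        have h1 : v ≤ k / 2 / (L + 1) := Nat.div_le_self _ _
        have h2 : k / 2 / (L + 1) ≤ k / 2 := Nat.div_le_self _ _
        omega
      have hκM : κ ≤ M := (Nat.mod_lt _ hK).le.trans hKM
      have htM : t ≤ M := by
        have : t < L + 1 := Nat.mod_lt _ (Nat.succ_pos L)
        omega
      have e1 := runs_block decode (r := 19) (S := S) (M := M) (μ := cells (out k))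
        (μ' := cells (out k))
        (l := [(out k).length, B, Nat.ofDigits B D, D.length, K, L, k, 2 * N - k,
          0, 0, 0, 0, 0, 0, 0, 0, 0, 0, 0])
        (l' := [(out k).length, B, Nat.ofDigits B D, D.length, K, L, k, 2 * N - k,
          v, κ, t, Nat.ofDigits B D, 0, 0, 0, D.length, 0, 0, 0]) rfl (by decide)
        (by
          simp only [List.mem_cons, List.not_mem_nil, or_false, forall_eq_or_imp, forall_eq]
          omega) hS
        (by simp [decode, Block.run, Instr.run, hv, hκ, ht])
      have e2 := hc (out k).length B K L k (2 * N - k) v κ t S M D (cells (out k))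
        (by omega) hBM hWM hDM hKM hLM (by omega) (by omega) hvM hκM htM hB hBS hDS hS hD
      obtain ⟨hr, hq, hf⟩ := foldl_scanStep_bounds (v := v) (κ := κ) D hB hD
      have hclause : 4 ≤ κ → (D.foldl (scanStep v κ) (0, 0, 0)).2.2 =
          if ClauseTrue cl v (κ - 4) then 1 else 0 := by
        intro h4
        rw [hDcl]
        exact foldl_scanStep v κ 0 0 cl (by omega)
      set r := (D.foldl (scanStep v κ) (0, 0, 0)).1
      set q := (D.foldl (scanStep v κ) (0, 0, 0)).2.1
      set f := (D.foldl (scanStep v κ) (0, 0, 0)).2.2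
      let l₀ : List ℕ := [(out k).length, B, Nat.ofDigits B D, D.length, K, L, k, 2 * N - k,
          v, κ, t, 0, r, q, f, 0, 0, 0, 0]
      let β := incidentExpr.eval fun i => l₀.getD i 0
      let l₁ : List ℕ := [(out k).length, B, Nat.ofDigits B D, D.length, K, L, k, 2 * N - k,
          v, κ, t, 0, r, q, β, 0, 0, 0, 0]
      let x := edgeExistsExpr.eval fun i => l₁.getD i 0
      let y := x * edgeEndExpr.eval fun i => l₁.getD i 0
      have hβ : β = if Incident cl v κ then 1 else 0 :=
        eval_incidentExpr (ρ := fun i => l₀.getD i 0) cl hclause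
      have hxy := eval_edgeExprs (ρ := fun i => l₁.getD i 0) (w := k) (Incident cl) rfl rfl rfl rfl
        hβ
      have hedge : (edgeAt K L (Incident cl) k = none ∧ x = 0 ∧ y = 0) ∨
          (edgeAt K L (Incident cl) k = some (k / 2, y) ∧ x = 1) := by
        rcases hxy with ⟨h1, h2⟩ | ⟨h1, h2⟩
        · exact Or.inl ⟨h1, h2, by simp only [y, x]; rw [h2, zero_mul]⟩
        · refine Or.inr ⟨?_, h2⟩
          have : y = edgeEndExpr.eval fun i => l₁.getD i 0 := by
            simp only [y, x]; rw [h2, one_mul]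
          rw [this]
          exact h1
      have hβ1 : β ≤ 1 := by rw [hβ]; split_ifs <;> omega
      have hxyM : x ≤ 1 ∧ y ≤ M := by
        rcases hedge with ⟨-, h1, h2⟩ | ⟨h1, h2⟩
        · omega
        · obtain ⟨-, h3, -⟩ := edgeAt_eq_some hK h1
          have := h3.lt (X := X) (by omega)
          omega
      have e3 := runs_block computeEdge (r := 19) (S := S) (M := M) (μ := cells (out k))
        (μ' := cells (out k)) (l := l₀)
        (l' := [(out k).length, B, Nat.ofDigits B D, D.length, K, L, k, 2 * N - k,
          v, κ, t, 0, r, q, β, 0, x, y, 0]) rfl (by decide)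
        (by
          simp only [l₀, List.mem_cons, List.not_mem_nil, or_false, forall_eq_or_imp, forall_eq]
          omega) hS rfl
      have e4 := runs_block writeEdge (r := 19) (S := S) (M := M) (hr := rfl) (hi := by decide)
        (hS := hS) (h := writeEdge_run B (Nat.ofDigits B D) D.length K L k (2 * N - k) v κ t r q β
          x y (out k) _ hedge)
        (hM := by
          simp only [List.mem_cons, List.not_mem_nil, or_false, forall_eq_or_imp, forall_eq]
          omega)
      rw [← hout, Nat.sub_sub] at e4
      refine (e1.seq (e2.seq (e3.seq e4))).mono ?_
      have : S + 1 ≤ (S + 1) ^ 3 := Nat.le_self_pow (by omega) _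
      rw [hwt]
      nlinarith [Nat.mul_le_mul_left decode.weight this,
        Nat.mul_le_mul_left computeEdge.weight this, Nat.mul_le_mul_left writeEdge.weight this])
  simp only [Nat.sub_zero, Nat.sub_self] at h
  refine h.mono ?_
  have h1 : S + 1 ≤ (S + 1) ^ 3 := Nat.le_self_pow (by omega) _
  calc 2 * N * (1 + S + wt * (S + 1) ^ 3) + 1
      ≤ 2 * N * ((S + 1) ^ 3 + wt * (S + 1) ^ 3) + (S + 1) ^ 3 := by
        gcongr
        · omega
        · omega
    _ ≤ (2 * wt + 3) * (N + 1) * (S + 1) ^ 3 := by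
        nlinarith [Nat.zero_le (wt * (S + 1) ^ 3), Nat.zero_le (N * (S + 1) ^ 3)]

end HyperbolicityReduction

/-! ### The construction of the instance of Hyperbolicity -/

namespace HyperbolicityReduction

open RAM RAM.Expr IncidenceGraph

/-- The number of variables on each side. -/
def side (n : ℕ) : ℕ := (n + 1) / 2

/-- The number of vectors: two assignments for each number below `2 ^ side n`, one for either side,
and three special vectors. -/
def vectors (n : ℕ) : ℕ := 2 * 2 ^ side n + 3

/-- Half of the length of the paths in the incidence graph, where `K` is the number of
coordinates. It exceeds the lower order terms in the distances by a constant factor. -/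
def halfLength (n K : ℕ) : ℕ := 6 * K + 6 * (side n + 3) + 1

/-- The number of vertices of the incidence graph for `n` variables and `K` coordinates. -/
def numVertices (n K : ℕ) : ℕ := order K (vectors n) (2 * halfLength n K)

/-- The hyperbolicity up to which the formula is unsatisfiable. -/
def threshold (n K : ℕ) : ℕ := 7 * halfLength n K + 2 * K + 2 * (side n + 3)

/-- The base in which a formula is packed into a single number, where `len` is the length of its
encoding. -/
def base (n len : ℕ) : ℕ := len + 2 * n + 2

/-- A bound for the sizes of all numbers in the construction. -/
def sizeBound (n K len : ℕ) : ℕ :=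
  base n len * len + side n + K + 2 * halfLength n K + 10

/-- Computing the base; register `9` holds the number of variables. -/
def packInit : Block :=
  [.set 1 (var 0 + 2 * var 9 + 2), .set 3 (var 0 - 2), .set 7 (var 0)]

def packDecrease : Block := [.set 7 (var 7 - 1)]

def packAppend : Block :=
  [.set 2 (var 2 * var 1 + var 16), .store (var 7) 0, .set 16 0]

/-- Packing the memory into register `2`, in the base given by register `1`, and clearing it. -/
def pack : Prog :=
  .loop 7 (.seq (packDecrease.compile 19) (.seq (.load 16 7) (packAppend.compile 19)))

/-- Splitting off the numbers of variables and clauses from the packed formula. -/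
def splitHeader : Block :=
  [.set 4 (var 2 / var 1 % var 1 + 4), .set 2 (var 2 / var 1 / var 1), .set 5 1,
    .set 18 ((var 9 + 1) / 2)]

def doubleBody : Block := [.set 5 (2 * var 5), .set 18 (var 18 - 1)]

/-- Doubling register `5` as often as register `18` says. -/
def double : Prog := .loop 18 (doubleBody.compile 19)

/-- Computing the parameters of the graph, and writing the number of vertices and the threshold. -/
def writeHeader : Block :=
  [.set 10 (6 * var 4 + 6 * ((var 9 + 1) / 2 + 3) + 1), .set 8 (2 * var 5 + 3),
    .set 5 (2 * var 10), .set 8 (var 8 * var 4 * (var 5 + 1)), .store 0 (var 8),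
    .store 1 (7 * var 10 + 2 * var 4 + 2 * ((var 9 + 1) / 2 + 3)), .set 0 2,
    .set 7 (2 * var 8), .set 8 0, .set 9 0, .set 10 0]

/-- Clearing all registers but register `0`, as the input of a program requires. -/
def cleanup : Block :=
  [.set 1 0, .set 2 0, .set 3 0, .set 4 0, .set 5 0, .set 6 0]

/-- The program that replaces a formula by an instance of Hyperbolicity. -/
def construct : Prog :=
  .seq (.load 9 8) (.seq (packInit.compile 19) (.seq pack (.seq (splitHeader.compile 19)
    (.seq double (.seq (writeHeader.compile 19) (.seq emit (cleanup.compile 19)))))))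

theorem runs_load {l : List ℕ} {μ : ℕ → ℕ} {i j S M : ℕ} (hi : i < l.length)
    (hj : j < l.length) (hl : ∀ x ∈ l, x ≤ M) (hμ : μ (l.getD j 0) ≤ M) (hS : M.size ≤ S) :
    Runs (.load i j) (cfg l μ) (cfg (l.set i (μ (l.getD j 0))) μ) (2 * (S + 1)) := by
  refine ⟨_, ?_, cfg_setReg hi ▸ Exec.load i j (cfg l μ)⟩
  have h1 := (size_mono hμ).trans hS
  have h2 : (l.getD j 0).size ≤ S := by
    rw [List.getD_eq_getElem _ _ hj]
    exact (size_mono (hl _ (List.getElem_mem hj))).trans hS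
  simp only [cfg]
  omega

theorem runs_pack : ∃ c, ∀ (B it n S M : ℕ) (x : List ℕ), (∀ y ∈ x, y < B) → 1 ≤ B → B ≤ M →
    Nat.ofDigits B x ≤ M → x.length ≤ M → it ≤ M → n ≤ M → x.length ≤ S → M.size ≤ S →
    Runs pack
      (cfg [x.length, B, 0, it, 0, 0, 0, x.length, 0, n, 0, 0, 0, 0, 0, 0, 0, 0, 0] (cells x))
      (cfg [x.length, B, Nat.ofDigits B x, it, 0, 0, 0, 0, 0, n, 0, 0, 0, 0, 0, 0, 0, 0, 0]
        (cells []))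
      (c * (S + 1) ^ 2) := by
  refine ⟨packDecrease.weight + packAppend.weight + 4, ?_⟩
  intro B it n S M x hx hB hBM hWM hlM hitM hnM hlS hS
  have hW : ∀ k, Nat.ofDigits B (x.drop k) ≤ M := fun k => by
    rw [← Nat.ofDigits_div_pow_eq_ofDigits_drop k (by omega) x hx]
    exact (Nat.div_le_self _ _).trans hWM
  have h := Runs.loop
    (p := .seq (packDecrease.compile 19) (.seq (.load 16 7) (packAppend.compile 19))) (i := 7)
    (B := S) (T := (packDecrease.weight + packAppend.weight + 2) * (S + 1))
    (fun k => cfg [x.length, B, Nat.ofDigits B (x.drop (x.length - k)), it, 0, 0, 0,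
      x.length - k, 0, n, 0, 0, 0, 0, 0, 0, 0, 0, 0] (cells (x.take (x.length - k)))) x.length
    (fun k hk => by simp [cfg]; omega)
    (fun k hk => by
      have : x.length - k ≤ M := by omega
      simpa [cfg] using (size_mono this).trans hS)
    (by simp [cfg])
    (fun k hk => by
      obtain ⟨j, hj⟩ : ∃ j, x.length - k = j + 1 := ⟨x.length - k - 1, by omega⟩
      have hj' : x.length - (k + 1) = j := by omega
      have hjl : j < x.length := by omega
      rw [hj, hj']
      have hget : cells (x.take (j + 1)) j = x[j] := by
        simp [cells, hjl, List.getD_eq_getElem?_getD]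
      have hxj : x[j] < B := hx _ (List.getElem_mem hjl)
      have hMj := hW (j + 1)
      have e1 := runs_block packDecrease (r := 19) (S := S) (M := M)
        (μ := cells (x.take (j + 1))) (μ' := cells (x.take (j + 1)))
        (l := [x.length, B, Nat.ofDigits B (x.drop (j + 1)), it, 0, 0, 0, j + 1, 0, n,
          0, 0, 0, 0, 0, 0, 0, 0, 0])
        (l' := [x.length, B, Nat.ofDigits B (x.drop (j + 1)), it, 0, 0, 0, j, 0, n,
          0, 0, 0, 0, 0, 0, 0, 0, 0]) rfl (by decide)
        (by
          simp only [List.mem_cons, List.not_mem_nil, or_false, forall_eq_or_imp, forall_eq]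
          omega) hS
        (by simp [packDecrease, Block.run, Instr.run])
      have e2 := runs_load (S := S) (M := M) (i := 16) (j := 7)
        (μ := cells (x.take (j + 1)))
        (l := [x.length, B, Nat.ofDigits B (x.drop (j + 1)), it, 0, 0, 0, j, 0, n,
          0, 0, 0, 0, 0, 0, 0, 0, 0]) (by simp) (by simp)
        (by
          simp only [List.mem_cons, List.not_mem_nil, or_false, forall_eq_or_imp, forall_eq]
          omega) (by
          change cells (x.take (j + 1)) j ≤ M
          rw [hget]; omega) hS
      have hl' : ([x.length, B, Nat.ofDigits B (x.drop (j + 1)), it, 0, 0, 0, j, 0, n,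
          0, 0, 0, 0, 0, 0, 0, 0, 0].set 16 (cells (x.take (j + 1))
          ([x.length, B, Nat.ofDigits B (x.drop (j + 1)), it, 0, 0, 0, j, 0, n,
          0, 0, 0, 0, 0, 0, 0, 0, 0].getD 7 0))) =
          [x.length, B, Nat.ofDigits B (x.drop (j + 1)), it, 0, 0, 0, j, 0, n,
          0, 0, 0, 0, 0, 0, x[j], 0, 0] := by
        rw [← hget]; rfl
      rw [hl'] at e2
      have hup : Function.update (cells (x.take (j + 1))) j 0 = cells (x.take j) := by
        have h1 := update_cells_length (x.take j) x[j]
        rw [List.length_take, min_eq_left hjl.le, ← List.take_succ_eq_append_getElem hjl] at h1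
        rw [← h1, Function.update_idem]
        exact update_cells_zero _ (by simp)
      have e3 := runs_block packAppend (r := 19) (S := S) (M := M)
        (μ := cells (x.take (j + 1))) (μ' := cells (x.take j))
        (l := [x.length, B, Nat.ofDigits B (x.drop (j + 1)), it, 0, 0, 0, j, 0, n,
          0, 0, 0, 0, 0, 0, x[j], 0, 0])
        (l' := [x.length, B, Nat.ofDigits B (x.drop j), it, 0, 0, 0, j, 0, n,
          0, 0, 0, 0, 0, 0, 0, 0, 0]) rfl (by decide)
        (by
          simp only [List.mem_cons, List.not_mem_nil, or_false, forall_eq_or_imp, forall_eq]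
          omega) hS
        (by
          rw [List.drop_eq_getElem_cons hjl, Nat.ofDigits_cons]
          simp [packAppend, Block.run, Instr.run, hup, add_comm, mul_comm])
      refine (e1.seq (e2.seq e3)).mono ?_
      nlinarith)
  simp only [Nat.sub_zero, Nat.sub_self, List.drop_zero, List.drop_length, List.take_length,
    List.take_zero, Nat.ofDigits_nil] at h
  refine h.mono ?_
  set wt := packDecrease.weight + packAppend.weight
  have h1 : x.length * (1 + S + (wt + 2) * (S + 1)) ≤ S * (1 + S + (wt + 2) * (S + 1)) :=
    Nat.mul_le_mul_right _ hlS
  nlinarith [Nat.zero_le wt, Nat.zero_le (wt * S)]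

theorem runs_double : ∃ c, ∀ (a0 a1 a2 a3 a4 a9 n S M : ℕ) (μ : ℕ → ℕ), a0 ≤ M → a1 ≤ M →
    a2 ≤ M → a3 ≤ M → a4 ≤ M → a9 ≤ M → 2 ^ n ≤ M → n ≤ S → M.size ≤ S →
    Runs double
      (cfg [a0, a1, a2, a3, a4, 1, 0, 0, 0, a9, 0, 0, 0, 0, 0, 0, 0, 0, n] μ)
      (cfg [a0, a1, a2, a3, a4, 2 ^ n, 0, 0, 0, a9, 0, 0, 0, 0, 0, 0, 0, 0, 0] μ)
      (c * (S + 1) ^ 2) := by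
  refine ⟨doubleBody.weight + 1, ?_⟩
  intro a0 a1 a2 a3 a4 a9 n S M μ h0 h1 h2 h3 h4 h9 hn hnS hS
  have hnM : n < 2 ^ n := Nat.lt_two_pow_self
  have h := Runs.loop (p := doubleBody.compile 19) (i := 18) (B := S)
    (T := doubleBody.weight * (S + 1))
    (fun k => cfg [a0, a1, a2, a3, a4, 2 ^ k, 0, 0, 0, a9, 0, 0, 0, 0, 0, 0, 0, 0, n - k] μ) n
    (fun k hk => by simp [cfg]; omega)
    (fun k hk => by
      have : n - k ≤ M := by omega
      simpa [cfg] using (size_mono this).trans hS)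
    (by simp [cfg])
    (fun k hk => by
      have hk2 : 2 ^ k ≤ 2 ^ n := Nat.pow_le_pow_right (by omega) hk.le
      refine runs_block doubleBody (r := 19) (S := S) (M := M) rfl (by decide) ?_ hS ?_
      · simp only [List.mem_cons, List.not_mem_nil, or_false, forall_eq_or_imp, forall_eq]
        omega
      · simp [doubleBody, Block.run, Instr.run, pow_succ, mul_comm, Nat.sub_sub])
  simp only [pow_zero, Nat.sub_zero, Nat.sub_self] at h
  refine h.mono ?_
  have : n * (1 + S + doubleBody.weight * (S + 1)) ≤ S * (1 + S + doubleBody.weight * (S + 1)) :=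
    Nat.mul_le_mul_right _ hnS
  nlinarith [Nat.zero_le doubleBody.weight, Nat.zero_le (doubleBody.weight * S)]

theorem init_eq_cfg (x : List ℕ) :
    RAM.init x = cfg [x.length, 0, 0, 0, 0, 0, 0, 0, 0, 0, 0, 0, 0, 0, 0, 0, 0, 0, 0]
      (cells x) := by
  unfold RAM.init cfg cells
  congr 1
  funext i
  by_cases h : i < 19
  · interval_cases i <;> rfl
  · rw [List.getD_eq_default _ _ (by simpa using h), if_neg (by omega)]

open Classical in
theorem runs_construct : ∃ c, ∀ (n : ℕ) (cl : List (List ℕ)) (D : List ℕ),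
    D = cl.flatMap (fun C => C.length :: C) → cl.length ≤ D.length →
    (∀ y ∈ D, y < base n (D.length + 2)) →
    Runs construct (RAM.init (n :: cl.length :: D))
      (RAM.init (numVertices n (cl.length + 4) :: threshold n (cl.length + 4) ::
        flatten (edges (cl.length + 4) (vectors n) (2 * halfLength n (cl.length + 4))
          (Incident cl))))
      (c * (numVertices n (cl.length + 4) + 1) *
        (sizeBound n (cl.length + 4) (D.length + 2) + 1) ^ 3) := by
  obtain ⟨c₁, hc₁⟩ := runs_pack
  obtain ⟨c₂, hc₂⟩ := runs_double
  obtain ⟨c₃, hc₃⟩ := runs_emit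
  refine ⟨2 + packInit.weight + c₁ + splitHeader.weight + c₂ + writeHeader.weight + c₃ +
    cleanup.weight, ?_⟩
  intro n cl D hDcl hclD hD
  set m := cl.length with hm
  set len := D.length + 2 with hlen
  set B := base n len with hBdef
  set K := m + 4 with hK
  set N := numVertices n K with hN
  set S := sizeBound n K len with hSdef
  set h := side n with hh
  have hBval : B = len + 2 * n + 2 := rfl
  have hNval : N = vectors n * K * (2 * halfLength n K + 1) := rfl
  have hXval : vectors n = 2 * 2 ^ h + 3 := rfl
  have hℓval : halfLength n K = 6 * K + 6 * (h + 3) + 1 := rfl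
  have hhval : h = (n + 1) / 2 := rfl
  set ℓ := halfLength n K with hℓdef
  have hX1 : 1 ≤ vectors n := by omega
  have hKN : K ≤ N := by
    rw [hNval]
    calc K = 1 * K * 1 := by ring
      _ ≤ _ := Nat.mul_le_mul (Nat.mul_le_mul_right K hX1) (by omega)
  have hLN : 2 * ℓ + 1 ≤ N := by
    rw [hNval]
    calc 2 * ℓ + 1 = 1 * 1 * (2 * ℓ + 1) := by ring
      _ ≤ _ := Nat.mul_le_mul_right _ (Nat.mul_le_mul hX1 (by omega))
  have hXN : vectors n ≤ N := by
    rw [hNval]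
    calc vectors n = vectors n * 1 * 1 := by ring
      _ ≤ _ := Nat.mul_le_mul (Nat.mul_le_mul_left _ (by omega)) (by omega)
  -- All numbers in registers and memory cells are bounded by the packed formula or by the length
  -- of the output.
  let M := B ^ len + 4 * N + 2
  have hMdef : M = B ^ len + 4 * N + 2 := rfl
  have hBlen : B ≤ B ^ len := Nat.le_self_pow (by omega) _
  set x := n :: m :: D with hx
  have hxlen : x.length = len := by simp [hx, hlen]
  have hxB : ∀ y ∈ x, y < B := by
    intro y hy
    simp only [hx, List.mem_cons] at hy
    rcases hy with rfl | rfl | hy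
    · omega
    · omega
    · exact hD y hy
  have hWB : Nat.ofDigits B x < B ^ len := by
    rw [← hxlen]
    exact Nat.ofDigits_lt_base_pow_length (by omega) hxB
  have hW : Nat.ofDigits B x = n + B * (m + B * Nat.ofDigits B D) := by
    rw [hx, Nat.ofDigits_cons, Nat.ofDigits_cons]
  have hWD : Nat.ofDigits B D ≤ Nat.ofDigits B x := by
    rw [hW]
    have h1 : m + B * Nat.ofDigits B D ≤ B * (m + B * Nat.ofDigits B D) :=
      Nat.le_mul_of_pos_left _ (by omega)
    have h2 : Nat.ofDigits B D ≤ B * Nat.ofDigits B D := Nat.le_mul_of_pos_left _ (by omega)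
    omega
  have hS : M.size ≤ S := by
    rw [Nat.size_le]
    have h1 : B ^ len ≤ 2 ^ (B * len) := by
      rw [pow_mul]
      exact Nat.pow_le_pow_left Nat.lt_two_pow_self.le _
    have h2 : N ≤ 2 ^ (h + 3) * 2 ^ K * 2 ^ (2 * ℓ + 1) := by
      rw [hNval]
      refine Nat.mul_le_mul (Nat.mul_le_mul ?_ Nat.lt_two_pow_self.le) Nat.lt_two_pow_self.le
      have : 1 ≤ 2 ^ h := Nat.one_le_two_pow
      rw [hXval, pow_add]
      omega
    rw [← pow_add, ← pow_add] at h2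
    set E := h + 3 + K + (2 * ℓ + 1) with hE
    have h3 : 2 ^ S = 2 ^ (B * len) * 2 ^ E * 64 := by
      have : S = B * len + E + 6 := by
        simp only [hSdef, hE, sizeBound, ← hBdef, ← hh, ← hℓdef]; ring
      rw [this, pow_add, pow_add]; norm_num
    have h4 : 1 ≤ 2 ^ (B * len) := Nat.one_le_two_pow
    have h5 : 1 ≤ 2 ^ E := Nat.one_le_two_pow
    rw [h3, hMdef]
    have h6 : 2 ^ (B * len) ≤ 2 ^ (B * len) * 2 ^ E := Nat.le_mul_of_pos_right _ h5
    have h7 : 2 ^ E ≤ 2 ^ (B * len) * 2 ^ E := Nat.le_mul_of_pos_left _ h4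
    omega
  have hBS : B ≤ S := by
    have : B * 1 ≤ B * len := Nat.mul_le_mul_left _ (by omega)
    simp only [hSdef, sizeBound, ← hBdef]
    omega
  have hhS : h ≤ S := by simp only [hSdef, sizeBound, ← hh]; omega
  have hlenM : len ≤ M := by omega
  have hSpow : S + 1 ≤ (N + 1) * (S + 1) ^ 3 := by
    calc S + 1 = 1 * (S + 1) := by ring
      _ ≤ (N + 1) * (S + 1) ^ 3 :=
        Nat.mul_le_mul (by omega) (Nat.le_self_pow (by omega) _)
  have hSpow2 : (S + 1) ^ 2 ≤ (N + 1) * (S + 1) ^ 3 := by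
    calc (S + 1) ^ 2 = 1 * (S + 1) ^ 2 := by ring
      _ ≤ (N + 1) * (S + 1) ^ 3 :=
        Nat.mul_le_mul (by omega) (Nat.pow_le_pow_right (by omega) (by omega))
  have e1 := runs_load (S := S) (M := M) (i := 9) (j := 8) (μ := cells x)
    (l := [len, 0, 0, 0, 0, 0, 0, 0, 0, 0, 0, 0, 0, 0, 0, 0, 0, 0, 0]) (by simp) (by simp)
    (by
      simp only [List.mem_cons, List.not_mem_nil, or_false, forall_eq_or_imp, forall_eq]
      omega)
    (by
      change n ≤ M
      omega) hS
  change Runs _ _ (cfg [len, 0, 0, 0, 0, 0, 0, 0, 0, n, 0, 0, 0, 0, 0, 0, 0, 0, 0] _) _ at e1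
  have e2 := runs_block packInit (r := 19) (S := S) (M := M) (μ := cells x) (μ' := cells x)
    (l := [len, 0, 0, 0, 0, 0, 0, 0, 0, n, 0, 0, 0, 0, 0, 0, 0, 0, 0])
    (l' := [len, B, 0, D.length, 0, 0, 0, len, 0, n, 0, 0, 0, 0, 0, 0, 0, 0, 0])
    rfl (by decide)
    (by
      simp only [List.mem_cons, List.not_mem_nil, or_false, forall_eq_or_imp, forall_eq]
      omega) hS
    (by simp [packInit, Block.run, Instr.run, hBval, hlen])
  have e3 := hc₁ B D.length n S M x hxB (by omega) (by omega) (by omega) (by omega) (by omega)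
    (by omega) (by omega) hS
  rw [hxlen] at e3
  have e4 := runs_block splitHeader (r := 19) (S := S) (M := M) (μ := cells []) (μ' := cells [])
    (l := [len, B, Nat.ofDigits B x, D.length, 0, 0, 0, 0, 0, n, 0, 0, 0, 0, 0, 0, 0, 0, 0])
    (l' := [len, B, Nat.ofDigits B D, D.length, K, 1, 0, 0, 0, n, 0, 0, 0, 0, 0, 0, 0, 0, h])
    rfl (by decide)
    (by
      simp only [List.mem_cons, List.not_mem_nil, or_false, forall_eq_or_imp, forall_eq]
      omega) hS
    (by
      have hB0 : 0 < B := by omega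
      have h1 : Nat.ofDigits B x / B = m + B * Nat.ofDigits B D := by
        rw [hW, Nat.add_mul_div_left _ _ hB0, Nat.div_eq_of_lt (by omega), zero_add]
      have h2 : (m + B * Nat.ofDigits B D) / B = Nat.ofDigits B D := by
        rw [Nat.add_mul_div_left _ _ hB0, Nat.div_eq_of_lt (by omega), zero_add]
      have h3 : (m + B * Nat.ofDigits B D) % B = m := by
        rw [Nat.add_mul_mod_self_left, Nat.mod_eq_of_lt (by omega)]
      simp [splitHeader, Block.run, Instr.run, h1, h2, h3, hK, hhval])
  have e5 := hc₂ len B (Nat.ofDigits B D) D.length K n h S M (cells []) (by omega) (by omega)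
    (by omega) (by omega) (by omega) (by omega) (by omega) hhS hS
  have e6 := runs_block writeHeader (r := 19) (S := S) (M := M) (μ := cells [])
    (μ' := cells [N, threshold n K])
    (l := [len, B, Nat.ofDigits B D, D.length, K, 2 ^ h, 0, 0, 0, n,
      0, 0, 0, 0, 0, 0, 0, 0, 0])
    (l' := [2, B, Nat.ofDigits B D, D.length, K, 2 * ℓ, 0, 2 * N, 0, 0,
      0, 0, 0, 0, 0, 0, 0, 0, 0])
    rfl (by decide)
    (by
      simp only [List.mem_cons, List.not_mem_nil, or_false, forall_eq_or_imp, forall_eq]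
      omega) hS
    (by
      have h1 := update_cells_length [] N
      have h2 := update_cells_length [N] (threshold n K)
      simp only [List.length_nil, List.length_singleton, List.nil_append,
        List.singleton_append] at h1 h2
      rw [← h2, ← h1]
      have h3 : (2 * 2 ^ h + 3) * K * (2 * ℓ + 1) = N := by rw [hNval, hXval]
      have h4 : 7 * ℓ + 2 * K + 2 * ((n + 1) / 2 + 3) = threshold n K := rfl
      have h5 : 6 * K + 6 * ((n + 1) / 2 + 3) + 1 = ℓ := rfl
      simp [writeHeader, Block.run, Instr.run, h3, h4, h5])
  have e7 := hc₃ K (vectors n) (2 * ℓ) B S M (threshold n K) cl D hDcl (by omega)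
    (by change 4 * N + 2 ≤ M; omega) (by omega) (by omega) (by omega) (by omega) (by omega)
    (by omega) hBS (by
      have : len ≤ B := by omega
      omega) hS hD
  change Runs emit
    (cfg [2, B, Nat.ofDigits B D, D.length, K, 2 * ℓ, 0, 2 * N, 0, 0, 0, 0, 0, 0, 0, 0, 0, 0, 0]
      (cells [N, threshold n K])) _ (c₃ * (N + 1) * (S + 1) ^ 3) at e7
  set out := N :: threshold n K :: flatten (edges K (vectors n) (2 * ℓ) (Incident cl)) with hout
  change Runs emit _ (cfg [out.length, B, Nat.ofDigits B D, D.length, K, 2 * ℓ, 2 * N,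
    0, 0, 0, 0, 0, 0, 0, 0, 0, 0, 0, 0] (cells out)) _ at e7
  have houtlen : out.length ≤ 4 * N + 2 := by
    have h1 : (edges K (vectors n) (2 * ℓ) (Incident cl)).length ≤ 2 * N := by
      refine (List.length_filterMap_le _ _).trans ?_
      rw [List.length_range]
      exact le_rfl
    rw [hout, List.length_cons, List.length_cons, flatten_length]
    omega
  have e8 := runs_block cleanup (r := 19) (S := S) (M := M) (μ := cells out) (μ' := cells out)
    (l := [out.length, B, Nat.ofDigits B D, D.length, K, 2 * ℓ, 2 * N,
      0, 0, 0, 0, 0, 0, 0, 0, 0, 0, 0, 0])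
    (l' := [out.length, 0, 0, 0, 0, 0, 0, 0, 0, 0, 0, 0, 0, 0, 0, 0, 0, 0, 0]) rfl (by decide)
    (by
      simp only [List.mem_cons, List.not_mem_nil, or_false, forall_eq_or_imp, forall_eq]
      omega) hS
    (by simp [cleanup, Block.run, Instr.run])
  rw [init_eq_cfg, init_eq_cfg, hxlen]
  refine (e1.seq (e2.seq (e3.seq (e4.seq (e5.seq (e6.seq (e7.seq e8))))))).mono ?_
  have i1 := Nat.mul_le_mul_left packInit.weight hSpow
  have i2 := Nat.mul_le_mul_left c₁ hSpow2
  have i3 := Nat.mul_le_mul_left splitHeader.weight hSpow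
  have i4 := Nat.mul_le_mul_left c₂ hSpow2
  have i5 := Nat.mul_le_mul_left writeHeader.weight hSpow
  have i6 := Nat.mul_le_mul_left cleanup.weight hSpow
  rw [mul_assoc c₃]
  rw [mul_assoc (2 + _ + _ + _ + _ + _ + _ + _) (N + 1)]
  simp only [add_mul] at *
  omega

end HyperbolicityReduction

/-! ### Satisfying assignments and disjoint vectors -/

namespace HyperbolicityReduction

open RAM IncidenceGraph

/-- The number that encodes a literal. -/
def litCode {n : ℕ} (l : Fin n × Bool) : ℕ := 2 * (l.1 : ℕ) + l.2.toNat

/-- The clauses of a formula, with their literals encoded. -/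
def clauses {n : ℕ} (φ : CNF n) : List (List ℕ) := φ.map fun C => C.map litCode

theorem encode_eq {n : ℕ} (φ : CNF n) :
    φ.encode = n :: (clauses φ).length :: (clauses φ).flatMap (fun C => C.length :: C) := by
  simp only [CNF.encode, clauses, List.flatMap_map, List.length_map]
  rfl

theorem litTrue_iff (v x : ℕ) (b : Bool) :
    LitTrue v (2 * x + b.toNat) ↔
      x % 2 = (v - 3) % 2 ∧ ((v - 3) / 2).testBit (x / 2) = b := by
  have hb : b.toNat < 2 := b.toNat_lt
  have h1 : (2 * x + b.toNat) / 2 = x := by omega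
  have h2 : (2 * x + b.toNat) / 4 = x / 2 := by omega
  have h3 : (2 * x + b.toNat) % 2 = b.toNat := by omega
  unfold LitTrue
  rw [h1, h2, h3, Nat.testBit_eq_decide_div_mod_eq]
  have h4 : (v - 3) / 2 / 2 ^ (x / 2) % 2 < 2 := Nat.mod_lt _ (by omega)
  cases b
  · simp only [Bool.toNat_false, decide_eq_false_iff_not]
    exact and_congr_right fun _ => by omega
  · simp only [Bool.toNat_true, decide_eq_true_eq]

theorem clauseTrue_iff {n : ℕ} (φ : CNF n) (v p : ℕ) :
    ClauseTrue (clauses φ) v p ↔ ∃ C, φ[p]? = some C ∧ ∃ l ∈ C,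
      (l.1 : ℕ) % 2 = (v - 3) % 2 ∧ ((v - 3) / 2).testBit ((l.1 : ℕ) / 2) = l.2 := by
  unfold ClauseTrue clauses
  simp only [List.getElem?_map, Option.map_eq_some_iff]
  constructor
  · rintro ⟨_, ⟨C, hC, rfl⟩, y, hy, hlit⟩
    obtain ⟨l, hl, rfl⟩ := List.mem_map.mp hy
    exact ⟨C, hC, l, hl, (litTrue_iff v l.1 l.2).mp hlit⟩
  · rintro ⟨C, hC, l, hl, h⟩
    exact ⟨_, ⟨C, hC, rfl⟩, _, List.mem_map_of_mem hl, (litTrue_iff v l.1 l.2).mpr h⟩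

theorem incident_assignment {cl : List (List ℕ)} {v κ : ℕ} (hv : 3 ≤ v) :
    Incident cl v κ ↔ if κ < 4 then κ % 2 = (v - 3) % 2 else ¬ ClauseTrue cl v (κ - 4) := by
  unfold Incident
  rw [if_neg (by omega), if_neg (by omega), if_neg (by omega)]

theorem incident_zero (cl : List (List ℕ)) (κ : ℕ) : Incident cl 0 κ := by simp [Incident]

theorem incident_one {cl : List (List ℕ)} {κ : ℕ} : Incident cl 1 κ ↔ κ / 2 = 0 := by
  simp [Incident]

theorem incident_two {cl : List (List ℕ)} {κ : ℕ} : Incident cl 2 κ ↔ κ / 2 = 1 := by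
  simp [Incident]

/-- The vector of an assignment meets both of the vectors `1` and `2`. -/
theorem incident_special {cl : List (List ℕ)} {v : ℕ} (hv : 3 ≤ v) :
    (∃ κ < cl.length + 4, Incident cl v κ ∧ Incident cl 1 κ) ∧
      ∃ κ < cl.length + 4, Incident cl v κ ∧ Incident cl 2 κ := by
  refine ⟨⟨(v - 3) % 2, by omega, ?_, ?_⟩, ⟨2 + (v - 3) % 2, by omega, ?_, ?_⟩⟩
  · rw [incident_assignment hv, if_pos (by omega)]; omega
  · rw [incident_one]; omega
  · rw [incident_assignment hv, if_pos (by omega)]; omega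
  · rw [incident_two]; omega

theorem exists_incident (cl : List (List ℕ)) (v : ℕ) : ∃ κ < cl.length + 4, Incident cl v κ := by
  by_cases h3 : 3 ≤ v
  · obtain ⟨κ, hκ, h, -⟩ := (incident_special (cl := cl) h3).1
    exact ⟨κ, hκ, h⟩
  · have : v = 0 ∨ v = 1 ∨ v = 2 := by omega
    rcases this with rfl | rfl | rfl
    · exact ⟨0, by omega, incident_zero cl 0⟩
    · exact ⟨0, by omega, by rw [incident_one]⟩
    · exact ⟨2, by omega, by rw [incident_two]⟩

/-- Disjoint vectors from different sides make up a satisfying assignment. -/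
theorem satisfiable_of_disjoint {n : ℕ} (φ : CNF n) {v w : ℕ} (hv : 3 ≤ v) (hw : 3 ≤ w)
    (hv2 : (v - 3) % 2 = 0) (hw2 : (w - 3) % 2 = 1)
    (hdis : ∀ κ < (clauses φ).length + 4,
      ¬ (Incident (clauses φ) v κ ∧ Incident (clauses φ) w κ)) : φ.Satisfiable := by
  refine ⟨fun x => if (x : ℕ) % 2 = 0 then ((v - 3) / 2).testBit ((x : ℕ) / 2)
    else ((w - 3) / 2).testBit ((x : ℕ) / 2), fun C hC => ?_⟩
  obtain ⟨p, hp, rfl⟩ := List.getElem_of_mem hC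
  have h := hdis (p + 4) (by simpa [clauses] using hp)
  rw [incident_assignment hv, incident_assignment hw, if_neg (by omega), if_neg (by omega),
    Nat.add_sub_cancel, not_and_or, not_not, not_not, clauseTrue_iff, clauseTrue_iff,
    List.getElem?_eq_getElem hp] at h
  simp only [Option.some.injEq] at h
  rcases h with ⟨_, rfl, l, hl, h1, h2⟩ | ⟨_, rfl, l, hl, h1, h2⟩
  · exact ⟨l, hl, by beta_reduce; rw [if_pos (by omega)]; exact h2⟩
  · exact ⟨l, hl, by beta_reduce; rw [if_neg (by omega)]; exact h2⟩

theorem exists_testBit (h : ℕ) (f : ℕ → Bool) :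
    ∃ i < 2 ^ h, ∀ p < h, i.testBit p = f p :=
  ⟨Nat.ofBits fun p : Fin h => f p, Nat.ofBits_lt_two_pow _, fun p hp =>
    Nat.testBit_ofBits_lt _ p hp⟩

/-- The two halves of a satisfying assignment are disjoint vectors. -/
theorem exists_disjoint {n : ℕ} (φ : CNF n) (hφ : φ.Satisfiable) :
    ∃ v w, 3 ≤ v ∧ 3 ≤ w ∧ v < vectors n ∧ w < vectors n ∧ v ≠ w ∧
      ∀ κ < (clauses φ).length + 4,
        ¬ (Incident (clauses φ) v κ ∧ Incident (clauses φ) w κ) := by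
  obtain ⟨σ, hσ⟩ := hφ
  let τ : ℕ → Bool := fun x => if hx : x < n then σ ⟨x, hx⟩ else false
  have hτ : ∀ x : Fin n, τ x = σ x := fun x => by simp [τ]
  obtain ⟨i, hi, hi'⟩ := exists_testBit (side n) fun p => τ (2 * p)
  obtain ⟨j, hj, hj'⟩ := exists_testBit (side n) fun p => τ (2 * p + 1)
  refine ⟨3 + 2 * i, 3 + (2 * j + 1), by omega, by omega, by unfold vectors; omega,
    by unfold vectors; omega, by omega, ?_⟩
  have hiv : (3 + 2 * i - 3) / 2 = i ∧ (3 + 2 * i - 3) % 2 = 0 := by omega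
  have hjw : (3 + (2 * j + 1) - 3) / 2 = j ∧ (3 + (2 * j + 1) - 3) % 2 = 1 := by omega
  rintro κ hκ ⟨h1, h2⟩
  rw [incident_assignment (by omega), hiv.2] at h1
  rw [incident_assignment (by omega), hjw.2] at h2
  by_cases h4 : κ < 4
  · rw [if_pos h4] at h1 h2
    omega
  · rw [if_neg h4, clauseTrue_iff, hiv.1, hiv.2] at h1
    rw [if_neg h4, clauseTrue_iff, hjw.1, hjw.2] at h2
    have hp : κ - 4 < φ.length := by
      have : (clauses φ).length = φ.length := by simp [clauses]
      omega
    obtain ⟨l, hl, hlit⟩ := hσ _ (List.getElem_mem hp)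
    have hside : (l.1 : ℕ) / 2 < side n := by
      have := l.1.2
      unfold side
      omega
    rcases Nat.mod_two_eq_zero_or_one (l.1 : ℕ) with hm | hm
    · refine h1 ⟨_, List.getElem?_eq_getElem hp, l, hl, hm, ?_⟩
      rw [hi' _ hside, show 2 * ((l.1 : ℕ) / 2) = l.1 by omega, hτ, hlit]
    · refine h2 ⟨_, List.getElem?_eq_getElem hp, l, hl, hm, ?_⟩
      rw [hj' _ hside, show 2 * ((l.1 : ℕ) / 2) + 1 = l.1 by omega, hτ, hlit]

theorem eq_special_of_disjoint {n : ℕ} (φ : CNF n) (hφ : ¬ φ.Satisfiable) {v w : ℕ}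
    (hvw : v ≠ w) (hdis : ∀ κ < (clauses φ).length + 4,
      ¬ (Incident (clauses φ) v κ ∧ Incident (clauses φ) w κ)) :
    v = 1 ∧ w = 2 ∨ v = 2 ∧ w = 1 := by
  have hv0 : v ≠ 0 := by
    rintro rfl
    obtain ⟨κ, hκ, h⟩ := exists_incident (clauses φ) w
    exact hdis κ hκ ⟨incident_zero _ _, h⟩
  have hw0 : w ≠ 0 := by
    rintro rfl
    obtain ⟨κ, hκ, h⟩ := exists_incident (clauses φ) v
    exact hdis κ hκ ⟨h, incident_zero _ _⟩
  by_cases hv : 3 ≤ v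
  · exfalso
    obtain ⟨⟨κ₁, hκ₁, h₁, h₁'⟩, ⟨κ₂, hκ₂, h₂, h₂'⟩⟩ := incident_special (cl := clauses φ) hv
    have hw1 : w ≠ 1 := by rintro rfl; exact hdis κ₁ hκ₁ ⟨h₁, h₁'⟩
    have hw2 : w ≠ 2 := by rintro rfl; exact hdis κ₂ hκ₂ ⟨h₂, h₂'⟩
    have hw : 3 ≤ w := by omega
    have hs := hdis ((v - 3) % 2) (by omega)
    rw [incident_assignment hv, incident_assignment hw, if_pos (by omega), if_pos (by omega)] at hs
    rcases Nat.mod_two_eq_zero_or_one (v - 3) with h | h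
    · exact hφ (satisfiable_of_disjoint φ hv hw h (by omega) hdis)
    · exact hφ (satisfiable_of_disjoint φ hw hv (by omega) h
        fun κ hκ h => hdis κ hκ h.symm)
  · by_cases hw : 3 ≤ w
    · exfalso
      obtain ⟨⟨κ₁, hκ₁, h₁, h₁'⟩, ⟨κ₂, hκ₂, h₂, h₂'⟩⟩ := incident_special (cl := clauses φ) hw
      have hv12 : v = 1 ∨ v = 2 := by omega
      rcases hv12 with rfl | rfl
      · exact hdis κ₁ hκ₁ ⟨h₁', h₁⟩
      · exact hdis κ₂ hκ₂ ⟨h₂', h₂⟩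
    · omega

/-- The incidence graph of the formula. -/
def formulaGraph {n : ℕ} (φ : CNF n) :
    SimpleGraph (Fin (numVertices n ((clauses φ).length + 4))) :=
  graph ((clauses φ).length + 4) (vectors n) (2 * halfLength n ((clauses φ).length + 4))
    (Incident (clauses φ))

theorem vectors_le (n : ℕ) : vectors n ≤ 2 ^ (side n + 3) := by
  have : 1 ≤ 2 ^ side n := Nat.one_le_two_pow
  unfold vectors
  rw [pow_add]
  omega

theorem formulaGraph_connected {n : ℕ} (φ : CNF n) : (formulaGraph φ).Connected :=
  connected (by unfold vectors; omega) (by omega) (fun κ _ => incident_zero _ κ)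
    fun v _ => exists_incident _ v

theorem isHyperbolic_formulaGraph {n : ℕ} (φ : CNF n) :
    (formulaGraph φ).IsHyperbolic (threshold n ((clauses φ).length + 4)) ↔ ¬ φ.Satisfiable := by
  constructor
  · intro h hφ
    obtain ⟨v, w, hv, hw, hvX, hwX, hvw, hdis⟩ := exists_disjoint φ hφ
    have hX : 3 ≤ vectors n := by unfold vectors; omega
    have hsv := incident_special (cl := clauses φ) hv
    have hsw := incident_special (cl := clauses φ) hw
    refine not_isHyperbolic (d := side n + 3) (c := 1) (e := 2) (vectors_le n) (by omega)
      (by unfold halfLength; omega) (fun κ _ => incident_zero _ κ)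
      (fun v _ => exists_incident _ v) hvX hwX (by omega) (by omega) hvw (by omega) hdis ?_
      hsv.1 hsv.2 hsw.1 hsw.2 h
    rintro κ - ⟨h1, h2⟩
    rw [incident_one] at h1
    rw [incident_two] at h2
    omega
  · intro hφ
    exact isHyperbolic (d := side n + 3) (vectors_le n) (by unfold vectors; omega) (by omega)
      (fun κ _ => incident_zero _ κ) (fun v _ => exists_incident _ v) 1 2
      fun v _ w _ hvw hdis => eq_special_of_disjoint φ hφ hvw hdis

end HyperbolicityReduction

/-! ### The lower bound -/

namespace HyperbolicityReduction

open RAM IncidenceGraph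

/-- A machine cannot write a number whose size exceeds the time. -/
theorem size_reg_le {p : Prog} {s s' : State} {t : ℕ} (h : Exec p s s' t) (i : ℕ) :
    (s'.reg i).size ≤ (s.reg i).size + t := by
  have hset : ∀ (s : State) (j v t : ℕ), v.size ≤ t →
      ((s.setReg j v).reg i).size ≤ (s.reg i).size + t := by
    intro s j v t hv
    by_cases hij : i = j
    · subst hij
      rw [State.setReg_reg_self]
      omega
    · rw [State.setReg_reg_of_ne _ _ hij]
      omega
  induction h with
  | const j c s => exact hset s j c _ (by omega)
  | arith o j k l s =>
    refine hset s j _ _ ((o.size_eval_le _ _).trans (by omega))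
  | load j k s => exact hset s j _ _ (by omega)
  | store j k s => exact Nat.le_add_right _ _
  | seq _ _ ih1 ih2 => omega
  | iteTrue _ _ ih => omega
  | iteFalse _ _ ih => omega
  | loopDone _ => omega
  | loopStep _ _ _ ih1 ih2 => omega

/-- The program that negates the answer in register `0`. -/
def negate : Prog := .ite 0 (.const 0 0) (.const 0 1)

theorem exec_negate (s : State) :
    ∃ s' t, Exec negate s s' t ∧ (s'.reg 0 ≠ 0 ↔ s.reg 0 = 0) ∧ t ≤ (s.reg 0).size + 3 := by
  by_cases h : s.reg 0 = 0
  · refine ⟨_, _, .iteFalse h (.const 0 1 s), ?_, ?_⟩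
    · rw [State.setReg_reg_self]; simp [h]
    · rw [Nat.size_one]; omega
  · refine ⟨_, _, .iteTrue h (.const 0 0 s), ?_, ?_⟩
    · rw [State.setReg_reg_self]; simp [h]
    · rw [Nat.size_zero]; omega

theorem length_le_length_flatMap (cl : List (List ℕ)) :
    cl.length ≤ (cl.flatMap fun C => C.length :: C).length := by
  induction cl with
  | nil => simp
  | cons C cl ih =>
    rw [List.flatMap_cons, List.length_append, List.length_cons, List.length_cons]
    omega

theorem length_le_of_mem {cl : List (List ℕ)} {C : List ℕ} (hC : C ∈ cl) :
    C.length ≤ (cl.flatMap fun C => C.length :: C).length := by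
  induction cl with
  | nil => simp at hC
  | cons C' cl ih =>
    rw [List.flatMap_cons, List.length_append, List.length_cons]
    rcases List.mem_cons.mp hC with rfl | h
    · omega
    · have := ih h
      omega

theorem length_flatMap_le {k : ℕ} {cl : List (List ℕ)} (hcl : ∀ C ∈ cl, C.length ≤ k) :
    (cl.flatMap fun C => C.length :: C).length ≤ (k + 1) * cl.length := by
  induction cl with
  | nil => simp
  | cons C cl ih =>
    rw [List.flatMap_cons, List.length_append, List.length_cons, List.length_cons, mul_add]
    have := ih fun C hC => hcl C (List.mem_cons_of_mem _ hC)
    have := hcl C (by simp)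
    omega

theorem mem_flatMap_lt {n : ℕ} (φ : CNF n) {D : List ℕ}
    (hD : D = (clauses φ).flatMap fun C => C.length :: C) :
    ∀ y ∈ D, y < base n (D.length + 2) := by
  intro y hy
  have hy' := hy
  rw [hD, List.mem_flatMap] at hy'
  obtain ⟨C, hC, hyC⟩ := hy'
  rcases List.mem_cons.mp hyC with rfl | hyC
  · have := length_le_of_mem hC
    rw [← hD] at this
    unfold base
    omega
  · obtain ⟨C', -, rfl⟩ := List.mem_map.mp hC
    obtain ⟨⟨x, b⟩, -, rfl⟩ := List.mem_map.mp hyC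
    have hb : b.toNat < 2 := b.toNat_lt
    have := x.2
    simp only [litCode, base]
    omega

theorem threshold_le_numVertices (n K : ℕ) (hK : 4 ≤ K) : threshold n K ≤ numVertices n K := by
  unfold numVertices order threshold
  have h1 : 5 ≤ vectors n := by
    have : 1 ≤ 2 ^ side n := Nat.one_le_two_pow
    unfold vectors; omega
  have h2 : 5 * 4 ≤ vectors n * K := Nat.mul_le_mul h1 hK
  have h3 : 5 * 4 * (2 * halfLength n K + 1) ≤ vectors n * K * (2 * halfLength n K + 1) :=
    Nat.mul_le_mul_right _ h2
  have h4 : 6 * K + 6 * (side n + 3) + 1 = halfLength n K := rfl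
  omega

/-- Deciding satisfiability with the help of a program for Hyperbolicity. -/
theorem exists_decidesWithin : ∃ c : ℕ, ∀ (P : Prog) {n : ℕ} (φ : CNF n) (T : ℝ),
    P.SolvesHyperbolicityOn (formulaGraph φ) T →
    (Prog.seq construct (.seq P negate)).DecidesWithin φ.encode φ.Satisfiable
      (c * ((numVertices n (φ.length + 4) + 1) *
        (sizeBound n (φ.length + 4) (φ.encode.length) + 1) ^ 3) + 2 * T) := by
  obtain ⟨c, hc⟩ := runs_construct
  refine ⟨c + 7, fun P n φ T hP => ?_⟩
  set D := (clauses φ).flatMap fun C => C.length :: C with hD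
  have hlen : (clauses φ).length = φ.length := by simp [clauses]
  have hrun := hc n (clauses φ) D hD (length_le_length_flatMap _) (mem_flatMap_lt φ hD)
  rw [← encode_eq] at hrun
  have henc : φ.encode.length = D.length + 2 := by rw [encode_eq, hD]; simp
  classical
  obtain ⟨es, hes, hmap⟩ := exists_isEdgeList (K := (clauses φ).length + 4) (X := vectors n)
    (L := 2 * halfLength n ((clauses φ).length + 4)) (I := Incident (clauses φ)) (by omega)
    (by unfold halfLength; omega)
  have hinput : encodeHyperbolicity (numVertices n ((clauses φ).length + 4))
      (threshold n ((clauses φ).length + 4)) es =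
      numVertices n ((clauses φ).length + 4) :: threshold n ((clauses φ).length + 4) ::
        flatten (edges ((clauses φ).length + 4) (vectors n)
          (2 * halfLength n ((clauses φ).length + 4)) (Incident (clauses φ))) := by
    rw [← hmap]
    simp only [encodeHyperbolicity, flatten, List.flatMap_map]
    rfl
  obtain ⟨s, t, hexec, hans, ht⟩ := hP (threshold n ((clauses φ).length + 4)) es
    (by unfold threshold halfLength; omega) (threshold_le_numVertices n _ (by omega)) hes
  have hinit : ((RAM.init (encodeHyperbolicity (numVertices n ((clauses φ).length + 4))
      (threshold n ((clauses φ).length + 4)) es)).reg 0).size ≤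
      4 * numVertices n ((clauses φ).length + 4) + 2 := by
    have h1 : (edges ((clauses φ).length + 4) (vectors n)
        (2 * halfLength n ((clauses φ).length + 4)) (Incident (clauses φ))).length ≤
        2 * numVertices n ((clauses φ).length + 4) := by
      refine (List.length_filterMap_le _ _).trans ?_
      rw [List.length_range]
      exact le_rfl
    rw [hinput]
    change (List.length _).size ≤ _
    rw [List.length_cons, List.length_cons, flatten_length]
    refine (Nat.size_le.mpr Nat.lt_two_pow_self).trans ?_
    omega
  have hsize := size_reg_le hexec 0
  rw [hinput] at hexec
  obtain ⟨t₁, ht₁, hexec₁⟩ := hrun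
  obtain ⟨s', t₂, hexec₂, hans₂, ht₂⟩ := exec_negate s
  refine ⟨s', _, .seq hexec₁ (.seq hexec hexec₂), ?_, ?_⟩
  · have h : s.reg 0 ≠ 0 ↔ ¬ φ.Satisfiable := hans.trans (isHyperbolic_formulaGraph φ)
    rw [hans₂]
    tauto
  · rw [← hlen, henc]
    set N := numVertices n ((clauses φ).length + 4)
    set S := sizeBound n ((clauses φ).length + 4) (D.length + 2)
    have h1 : (t₁ + (t + t₂) : ℕ) ≤ (c + 7) * ((N + 1) * (S + 1) ^ 3) + 2 * t := by
      have h2 : N + 1 ≤ (N + 1) * (S + 1) ^ 3 :=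
        Nat.le_mul_of_pos_right _ (by positivity)
      have h3 : t₁ ≤ c * ((N + 1) * (S + 1) ^ 3) := by rwa [← mul_assoc]
      rw [add_mul]
      omega
    have h2 : ((t₁ + (t + t₂) : ℕ) : ℝ) ≤
        ((((c + 7) * ((N + 1) * (S + 1) ^ 3) + 2 * t : ℕ)) : ℝ) := by exact_mod_cast h1
    refine h2.trans ?_
    push_cast
    linarith

theorem numVertices_le (n m : ℕ) :
    numVertices n (m + 4) ≤ 2000 * (n + m + 1) ^ 2 * 2 ^ side n := by
  have h1 : vectors n ≤ 5 * 2 ^ side n := by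
    have : 1 ≤ 2 ^ side n := Nat.one_le_two_pow
    unfold vectors; omega
  have h2 : m + 4 ≤ 4 * (n + m + 1) := by omega
  have h3 : 2 * halfLength n (m + 4) + 1 ≤ 100 * (n + m + 1) := by
    unfold halfLength side; omega
  calc numVertices n (m + 4)
      ≤ 5 * 2 ^ side n * (4 * (n + m + 1)) * (100 * (n + m + 1)) :=
        Nat.mul_le_mul (Nat.mul_le_mul h1 h2) h3
    _ = 2000 * (n + m + 1) ^ 2 * 2 ^ side n := by ring

theorem sizeBound_le {k n m len : ℕ} (hlen : len ≤ (k + 3) * (n + m + 1)) :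
    sizeBound n (m + 4) len + 1 ≤ ((k + 7) * (k + 3) + 150) * (n + m + 1) ^ 2 := by
  set Y := n + m + 1 with hY
  have h1 : base n len ≤ (k + 7) * Y := by
    unfold base
    nlinarith
  have h2 : base n len * len ≤ (k + 7) * Y * ((k + 3) * Y) := Nat.mul_le_mul h1 hlen
  have h3 : side n + (m + 4) + 2 * halfLength n (m + 4) + 10 + 1 ≤ 150 * Y := by
    unfold halfLength side; omega
  have h4 : Y ≤ Y ^ 2 := Nat.le_self_pow (by omega) _
  unfold sizeBound
  calc _ ≤ (k + 7) * Y * ((k + 3) * Y) + 150 * Y ^ 2 := by omega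
    _ = ((k + 7) * (k + 3) + 150) * Y ^ 2 := by ring

/-- The number of vertices is the square root of `2 ^ n`, up to polynomial factors. -/
theorem numVertices_le_rpow (n m : ℕ) :
    (numVertices n (m + 4) : ℝ) ≤ 4000 * ((n : ℝ) + m + 1) ^ 2 * (2 : ℝ) ^ ((n : ℝ) / 2) := by
  have h1 : (numVertices n (m + 4) : ℝ) ≤ 2000 * ((n : ℝ) + m + 1) ^ 2 * 2 ^ side n := by
    exact_mod_cast numVertices_le n m
  have h2 : (2 : ℝ) ^ side n ≤ 2 * (2 : ℝ) ^ ((n : ℝ) / 2) := by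
    have h3 : (side n : ℝ) ≤ 1 + (n : ℝ) / 2 := by
      have : 2 * side n ≤ n + 1 := by unfold side; omega
      have h' : (2 * side n : ℝ) ≤ n + 1 := by exact_mod_cast this
      linarith
    calc (2 : ℝ) ^ side n = (2 : ℝ) ^ (side n : ℝ) := (Real.rpow_natCast _ _).symm
      _ ≤ (2 : ℝ) ^ (1 + (n : ℝ) / 2) := Real.rpow_le_rpow_of_exponent_le (by norm_num) h3
      _ = _ := by rw [Real.rpow_add (by norm_num), Real.rpow_one]
  refine h1.trans ?_
  have h3 : (0 : ℝ) ≤ 2000 * ((n : ℝ) + m + 1) ^ 2 := by positivity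
  nlinarith [mul_le_mul_of_nonneg_left h2 h3]

/-- A subquadratic time bound in the number of vertices becomes a time bound with an improved
base of the exponential in the number of variables. -/
theorem numVertices_rpow_le (n m : ℕ) {ε η : ℝ} (hη : 0 < η) (hη1 : η ≤ 1) (hηε : η ≤ ε) :
    (numVertices n (m + 4) : ℝ) ^ (2 - ε) ≤
      4000 ^ 2 * ((n : ℝ) + m + 1) ^ 4 * (2 : ℝ) ^ ((1 - η / 2) * n) := by
  have hN1 : (1 : ℝ) ≤ numVertices n (m + 4) := by
    have : 1 ≤ numVertices n (m + 4) :=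
      le_trans (by unfold threshold; omega) (threshold_le_numVertices n (m + 4) (by omega))
    exact_mod_cast this
  have hY : (1 : ℝ) ≤ (n : ℝ) + m + 1 := by
    have : (0 : ℝ) ≤ (n : ℝ) + m := by positivity
    linarith
  set Y := (n : ℝ) + m + 1
  have hY2 : (1 : ℝ) ≤ 4000 * Y ^ 2 := by nlinarith
  calc (numVertices n (m + 4) : ℝ) ^ (2 - ε)
      ≤ (numVertices n (m + 4) : ℝ) ^ (2 - η) :=
        Real.rpow_le_rpow_of_exponent_le hN1 (by linarith)
    _ ≤ (4000 * Y ^ 2 * (2 : ℝ) ^ ((n : ℝ) / 2)) ^ (2 - η) :=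
        Real.rpow_le_rpow (by linarith) (numVertices_le_rpow n m) (by linarith)
    _ = (4000 * Y ^ 2) ^ (2 - η) * (2 : ℝ) ^ ((1 - η / 2) * n) := by
        rw [Real.mul_rpow (by positivity) (by positivity), ← Real.rpow_mul (by norm_num)]
        congr 2
        ring
    _ ≤ (4000 * Y ^ 2) ^ (2 : ℝ) * (2 : ℝ) ^ ((1 - η / 2) * n) := by
        gcongr
        · linarith
    _ = _ := by
        rw [Real.rpow_two]
        ring

theorem length_encode_le {k n : ℕ} (φ : CNF n) (hφ : φ.IsKCNF k) :
    φ.encode.length ≤ (k + 3) * (n + φ.length + 1) := by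
  have h1 : ((clauses φ).flatMap fun C => C.length :: C).length ≤ (k + 1) * (clauses φ).length := by
    apply length_flatMap_le
    intro C hC
    obtain ⟨C', hC', rfl⟩ := List.mem_map.mp hC
    rw [List.length_map]
    exact hφ C' hC'
  have h2 : (clauses φ).length = φ.length := by simp [clauses]
  rw [h2] at h1
  rw [encode_eq, List.length_cons, List.length_cons]
  nlinarith

theorem not_solvable_of_maxDegree_le_five (hSETH : SETH) (c ε : ℝ) (hε : 0 < ε) :
    ¬ ∃ P : RAM.Prog, ∀ (n : ℕ) (G : SimpleGraph (Fin n)) [DecidableRel G.Adj],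
      G.Connected → G.maxDegree ≤ 5 → P.SolvesHyperbolicityOn G (c * (n : ℝ) ^ (2 - ε)) := by
  rintro ⟨P, hP⟩
  obtain ⟨c₁, hc₁⟩ := exists_decidesWithin
  set η := min ε 1
  have hη : 0 < η := lt_min hε one_pos
  obtain ⟨k, hk⟩ := hSETH (η / 2) (by linarith)
  apply hk
  set s := (k + 7) * (k + 3) + 150
  refine ⟨.seq construct (.seq P negate), 8000 * c₁ * s ^ 3 + 2 * ⌈|c|⌉₊ * 4000 ^ 2, 8,
    fun n φ hφ => ?_⟩
  classical
  have hsolve := hP _ (formulaGraph φ) (formulaGraph_connected φ)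
    (maxDegree_le (by unfold halfLength; omega))
  obtain ⟨st, t, hexec, hans, ht⟩ := hc₁ P φ _ hsolve
  refine ⟨st, t, hexec, hans, ht.trans ?_⟩
  have hlen : (clauses φ).length = φ.length := by simp [clauses]
  rw [hlen]
  have hS := sizeBound_le (length_encode_le φ hφ)
  set m := φ.length
  have hY : (1 : ℝ) ≤ (n : ℝ) + m + 1 := by
    have : (0 : ℝ) ≤ (n : ℝ) + m := by positivity
    linarith
  have hS' : ((sizeBound n (m + 4) φ.encode.length : ℝ) + 1) ≤ s * ((n : ℝ) + m + 1) ^ 2 := by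
    exact_mod_cast hS
  have hN := numVertices_le_rpow n m
  have hN' := numVertices_rpow_le n m hη (min_le_right _ _) (min_le_left ε 1)
  have hE : (2 : ℝ) ^ ((n : ℝ) / 2) ≤ (2 : ℝ) ^ ((1 - η / 2) * n) := by
    apply Real.rpow_le_rpow_of_exponent_le (by norm_num)
    have h1 : η ≤ 1 := min_le_right _ _
    nlinarith [(Nat.cast_nonneg n : (0 : ℝ) ≤ n)]
  have hE1 : (1 : ℝ) ≤ (2 : ℝ) ^ ((n : ℝ) / 2) :=
    Real.one_le_rpow (by norm_num) (by positivity)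
  set Y := (n : ℝ) + m + 1
  set E := (2 : ℝ) ^ ((1 - η / 2) * n)
  set N := (numVertices n (m + 4) : ℝ)
  have hN0 : 0 ≤ N := Nat.cast_nonneg _
  have hNE : N + 1 ≤ 8000 * Y ^ 2 * E := by
    have h1 : 1 ≤ Y ^ 2 := by nlinarith
    have h2 : 4000 * Y ^ 2 * (2 : ℝ) ^ ((n : ℝ) / 2) ≤ 4000 * Y ^ 2 * E := by gcongr
    have h3 : 1 ≤ Y ^ 2 * E := one_le_mul_of_one_le_of_one_le h1 (hE1.trans hE)
    linarith
  have hconstr : (c₁ : ℝ) * ((N + 1) * ((sizeBound n (m + 4) φ.encode.length : ℝ) + 1) ^ 3) ≤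
      8000 * c₁ * s ^ 3 * E * Y ^ 8 := by
    calc _ ≤ (c₁ : ℝ) * ((8000 * Y ^ 2 * E) * (s * Y ^ 2) ^ 3) := by gcongr
      _ = _ := by ring
  have hcc : c ≤ (⌈|c|⌉₊ : ℝ) := (le_abs_self c).trans (Nat.le_ceil _)
  have hsolve' : 2 * (c * N ^ (2 - ε)) ≤ 2 * ⌈|c|⌉₊ * 4000 ^ 2 * E * Y ^ 8 := by
    have h1 : Y ^ 4 ≤ Y ^ 8 := pow_le_pow_right₀ hY (by norm_num)
    calc 2 * (c * N ^ (2 - ε)) ≤ 2 * (⌈|c|⌉₊ * (4000 ^ 2 * Y ^ 8 * E)) := by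
          gcongr 2 * ?_
          refine mul_le_mul hcc (hN'.trans ?_) (Real.rpow_nonneg hN0 _) (Nat.cast_nonneg _)
          gcongr
      _ = _ := by ring
  push_cast
  linarith

end HyperbolicityReduction

/-- Assuming SETH, Hyperbolicity cannot be solved in time `f(Δ) * n ^ (2 - ε)`, where `Δ` is the
maximum degree and `f` is any function, not even on connected graphs; and on connected graphs of
maximum degree at most five it cannot be solved in time `O(n ^ (2 - ε))`. -/
theorem mainTheorem7 (hSETH : SETH) :
    (∀ (f : ℕ → ℝ) (ε : ℝ), 0 < ε →
      ¬ ∃ P : RAM.Prog, ∀ (n : ℕ) (G : SimpleGraph (Fin n)) [DecidableRel G.Adj],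
        G.Connected →
          P.SolvesHyperbolicityOn G (f G.maxDegree * (n : ℝ) ^ (2 - ε))) ∧
    (∀ (c : ℝ) (ε : ℝ), 0 < ε →
      ¬ ∃ P : RAM.Prog, ∀ (n : ℕ) (G : SimpleGraph (Fin n)) [DecidableRel G.Adj],
        G.Connected → G.maxDegree ≤ 5 →
          P.SolvesHyperbolicityOn G (c * (n : ℝ) ^ (2 - ε))) := by
  refine ⟨?_, HyperbolicityReduction.not_solvable_of_maxDegree_le_five hSETH⟩
  rintro f ε hε ⟨P, hP⟩
  -- On graphs of maximum degree at most five, the values of `f` are bounded by a constant.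
  refine HyperbolicityReduction.not_solvable_of_maxDegree_le_five hSETH
    (∑ i ∈ Finset.range 6, |f i|) ε hε ⟨P, fun n G _ hG hdeg δ es h1 h2 hes => ?_⟩
  obtain ⟨s, t, hexec, hans, ht⟩ := hP n G hG δ es h1 h2 hes
  refine ⟨s, t, hexec, hans, ht.trans ?_⟩
  have hf : f G.maxDegree ≤ ∑ i ∈ Finset.range 6, |f i| :=
    (le_abs_self _).trans (Finset.single_le_sum (f := fun i => |f i|) (fun i _ => abs_nonneg _)
      (Finset.mem_range.mpr (by omega)))
  exact mul_le_mul_of_nonneg_right hf (Real.rpow_nonneg (Nat.cast_nonneg n) _)
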